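/- Let $n,N\ge 1$. For $s\in\{1,-1\}^n$, n-NLS$^s$ denotes the system $$\mathrm{i}\,\partial_t\psi_j+\partial_x^2\psi_j+2\Big(\sum_{k=1}^n s_k|\psi_k|^2\Big)\psi_j=0,\qquad j=1,\dots,n,$$ for complex-valued functions $\psi_j(x,t)$ of real variables $x,t$. Let $\theta\in\mathbb{R}$, $w_{a_j},\gamma_j\in\mathbb{R}\setminus\{0\}$ for $1\le j\le n$, and let $w_{v_{2k-1}},\hat d_{2k-1}\in\mathbb{C}$ for $1\le k\le N$. Put $s_j=\operatorname{sign}(\gamma_j)$, $w_{u_{2k}}=\overline{w_{v_{2k-1}}}$, $\hat d_{2k}=\overline{\hat d_{2k-1}}$, $$\alpha_{u_{2k-1}}=\sum_{j=1}^{n}\gamma_j\left(\frac1{w_{a_j}}-\frac1{w_{a_j}-w_{v_{2k-1}}}\right),\qquad \alpha_{v_{2k}}=\overline{\alpha_{u_{2k-1}}},$$ $$z_{2k-1}=\mathrm{i}\,\alpha_{u_{2k-1}}x+\mathrm{i}\,\alpha_{u_{2k-1}}^2t-\hat d_{2k-1},\qquad z_{2k}=\overline{z_{2k-1}},$$ $$\hat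 r_{j,2k-1}=\ln\left\{\frac{w_{a_j}-w_{v_{2k-1}}}{w_{a_j}\,w_{v_{2k-1}}\,\alpha_{u_{2k-1}}}\right\},\qquad \hat r_{j,2k}=-\overline{\hat r_{j,2k-1}} .$$ Assume that $w_{v_{2k-1}}\ne w_{u_{2l}}$ and $\alpha_{u_{2k-1}}\neq\alpha_{v_{2l}}$ for all $1\le k,l\le N$ (in particular these numbers are not real, and all denominators in this statement except possibly $\det\mathbb M$ are nonzero). Let $\mathbb{K}_j$ and $\mathbb{M}$ be the $2N\times 2N$ matrices with the following entries. - For $i,k$ even: $$(\mathbb{K}_j)_{ik}=\delta_{2,i}\frac{w_{u_i}}{w_{u_k}}e^{\frac12(z_2+z_k+\hat r_{j,2}+\hat r_{j,k})}+\delta_{i,k}-\delta_{2,i}\delta_{2,k}+\delta_{2,k}(\delta_{2,i}-1)\frac{w_{u_i}}{w_{u_2}}e^{\frac12(z_i-z_2+\hat r_{j,i}-\hat r_{j,2})}.$$ - For $i$ even, $k$ odd: $$(\mathbb{K}_j)_{ik}=\alpha_{u_k}^2\frac{w_{u_i}}{\alpha_{v_i}-\alpha_{u_k}}\,\frac{\alpha_{v_2}-\alpha_{v_i}}{\alpha_{v_2}-\alpha_{u_k}}\,e^{\frac12(z_i+z_k+\hat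 r_{j,i}+\hat r_{j,k})},\qquad (\mathbb{M})_{ik}=\alpha_{u_k}\alpha_{v_i}\frac{w_{u_i}}{\alpha_{v_i}-\alpha_{u_k}}\,e^{\frac12(z_i+z_k)}.$$ - For $i$ odd, $k$ even: $$(\mathbb{K}_j)_{ik}=\frac{w_{v_i}}{w_{v_i}-w_{u_k}}\,e^{\frac12(z_i+z_k+\hat r_{j,i}+\hat r_{j,k})},\qquad (\mathbb{M})_{ik}=\frac{w_{v_i}}{w_{v_i}-w_{u_k}}\,e^{\frac12(z_i+z_k)}.$$ - For $i,k$ odd: $(\mathbb{K}_j)_{ik}=(\mathbb{M})_{ik}=\delta_{i,k}$. For $i,k$ even: $(\mathbb{M})_{ik}=\delta_{i,k}$. Then the functions $$\psi_j(x,t)=\frac{|\gamma_j|^{1/2}}{|w_{a_j}|}\,e^{\mathrm{i}\theta}\,\frac{\det\mathbb{K}_j}{\det\mathbb{M}},\qquad j=1,\dots,n,$$ are smooth and solve n-NLS$^s$ on the set of $(x,t)\in\mathbb{R}^2$ where $\det\mathbb{M}\ne0$. Moreover, if the numbers $\alpha_{u_1},\alpha_{u_3},\dots,\alpha_{u_{2N-1}}$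 are pairwise distinct, these solutions are bright: for every $t\in\mathbb{R}$ one has $\det\mathbb{M}(x,t)\neq0$ for all $x\in\mathbb R$ with $|x|$ large enough, and $\psi_j(x,t)\to0$ as $|x|\to\infty$ for every $j$. -/

import Mathlib

open scoped ContDiff ComplexConjugate

noncomputable section

namespace BrightSoliton

/-- The functions `ψ 0, …, ψ (n-1)` of the real variables `(x, t)` are smooth on the set `U` and
satisfy there the `n`-component nonlinear Schroedinger equation with signs `s`,
`i ∂ψⱼ/∂t + ∂²ψⱼ/∂x² + 2 (∑ₖ sₖ |ψₖ|²) ψⱼ = 0` for every `j`. -/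
def IsNLSSolutionOn {n : ℕ} (s : Fin n → ℝ) (ψ : Fin n → ℝ → ℝ → ℂ) (U : Set (ℝ × ℝ)) : Prop :=
  (∀ j, ContDiffOn ℝ ∞ (fun p : ℝ × ℝ => ψ j p.1 p.2) U) ∧
  ∀ x t : ℝ, (x, t) ∈ U → ∀ j,
    Complex.I * deriv (fun τ => ψ j x τ) t + iteratedDeriv 2 (fun y => ψ j y t) x
      + 2 * ((∑ k, s k * ‖ψ k x t‖ ^ 2 : ℝ) : ℂ) * ψ j x t = 0

/-!
Parameters, for `n` components and `N` solitons: `a j` is the real number `w_{a_j}`, `γ j` is real,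
`w k` is `w_{v_{2k-1}}` (so that `w_{u_{2k}} = conj (w k)`), and `d k` is the constant
`d_{2k-1}` (so that `d_{2k} = conj (d k)`).  The index `k : Fin N` starts at `0`, i.e.
it stands for `k + 1` in the usual numbering.
-/

/-- `α_{u_{2k-1}} = ∑ⱼ γⱼ (1 / w_{a_j} - 1 / (w_{a_j} - w_{v_{2k-1}}))`; also
`α_{v_{2k}} = conj α_{u_{2k-1}}`. -/
def alpha {n N : ℕ} (a γ : Fin n → ℝ) (w : Fin N → ℂ) (k : Fin N) : ℂ :=
  ∑ j, (γ j : ℂ) * (1 / (a j : ℂ) - 1 / ((a j : ℂ) - w k))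

/-- An index in `{1, …, 2N}` is encoded as `Sum.inl k` for the odd index `2k-1` and `Sum.inr k` for
the even index `2k`.  (Determinants do not depend on the order of the index set.) -/
abbrev Idx (N : ℕ) : Type := Fin N ⊕ Fin N

/-- The linear functions `z_{2k-1} = i α_{u_{2k-1}} x + i α_{u_{2k-1}}² t - d_{2k-1}`
and `z_{2k} = conj z_{2k-1}`. -/
def z {n N : ℕ} (a γ : Fin n → ℝ) (w d : Fin N → ℂ) (x t : ℝ) : Idx N → ℂ
  | .inl k => Complex.I * alpha a γ w k * x + Complex.I * alpha a γ w k ^ 2 * t - d k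
  | .inr k => conj (Complex.I * alpha a γ w k * x + Complex.I * alpha a γ w k ^ 2 * t - d k)

/-- The scalars `r_{j,2k-1} = ln ((w_{a_j} - w_{v_{2k-1}}) / (w_{a_j} w_{v_{2k-1}} α_{u_{2k-1}}))`
and `r_{j,2k} = - conj r_{j,2k-1}`. -/
def r {n N : ℕ} (a γ : Fin n → ℝ) (w : Fin N → ℂ) (j : Fin n) : Idx N → ℂ
  | .inl k => Complex.log (((a j : ℂ) - w k) / ((a j : ℂ) * w k * alpha a γ w k))
  | .inr k => -conj (Complex.log (((a j : ℂ) - w k) / ((a j : ℂ) * w k * alpha a γ w k)))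

/-- The matrix `M`. -/
def matM {n N : ℕ} (a γ : Fin n → ℝ) (w d : Fin N → ℂ) (x t : ℝ) :
    Matrix (Idx N) (Idx N) ℂ :=
  let αu : Fin N → ℂ := alpha a γ w
  let αv : Fin N → ℂ := fun k => conj (alpha a γ w k)
  let wv : Fin N → ℂ := w
  let wu : Fin N → ℂ := fun k => conj (w k)
  let E : Idx N → Idx N → ℂ := fun p q =>
    Complex.exp ((1 / 2) * (z a γ w d x t p + z a γ w d x t q))
  Matrix.of fun p q => match p, q with
    | .inr i, .inr k => if i = k then 1 else 0
    | .inl i, .inl k => if i = k then 1 else 0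
    | .inr i, .inl k => αu k * αv i * (wu i / (αv i - αu k)) * E (.inr i) (.inl k)
    | .inl i, .inr k => wv i / (wv i - wu k) * E (.inl i) (.inr k)

/-- The matrix `K_j`.  The even index `2` is `Sum.inr 0`. -/
def matK {n N : ℕ} [NeZero N] (a γ : Fin n → ℝ) (w d : Fin N → ℂ) (j : Fin n) (x t : ℝ) :
    Matrix (Idx N) (Idx N) ℂ :=
  let αu : Fin N → ℂ := alpha a γ w
  let αv : Fin N → ℂ := fun k => conj (alpha a γ w k)
  let wv : Fin N → ℂ := w
  let wu : Fin N → ℂ := fun k => conj (w k)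
  let ζ : Idx N → ℂ := fun p => z a γ w d x t p + r a γ w j p
  let E : Idx N → Idx N → ℂ := fun p q => Complex.exp ((1 / 2) * (ζ p + ζ q))
  let δ : Fin N → Fin N → ℂ := fun i k => if i = k then 1 else 0
  Matrix.of fun p q => match p, q with
    | .inr i, .inr k =>
        δ 0 i * (wu i / wu k) * E (.inr 0) (.inr k) + δ i k - δ 0 i * δ 0 k
          + δ 0 k * (δ 0 i - 1) * (wu i / wu 0)
            * Complex.exp ((1 / 2) * (ζ (.inr i) - ζ (.inr 0)))
    | .inr i, .inl k =>
        αu k ^ 2 * (wu i / (αv i - αu k)) * ((αv 0 - αv i) / (αv 0 - αu k)) * E (.inr i) (.inl k)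
    | .inl i, .inr k => wv i / (wv i - wu k) * E (.inl i) (.inr k)
    | .inl i, .inl k => δ i k

/-- `ψⱼ = Aⱼ e^{iθ} det Kⱼ / det M` with `Aⱼ = |γⱼ|^{1/2} / |w_{a_j}|`. -/
def psi {n N : ℕ} [NeZero N] (a γ : Fin n → ℝ) (θ : ℝ) (w d : Fin N → ℂ)
    (j : Fin n) (x t : ℝ) : ℂ :=
  ((Real.sqrt |γ j| / |a j| : ℝ) : ℂ) * Complex.exp (Complex.I * θ)
    * ((matK a γ w d j x t).det / (matM a γ w d x t).det)

end BrightSoliton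

end

/-!
The quotients of determinants are rewritten as the components of a vector soliton
`Ψ = C diag(ε) X`, where `X` solves the linear system `(1 - L R) X = 1`.  Here `ε` consists of the
plane waves `c_l exp(-i B_l x - i B_l² t)` with `B = conj α`, the matrix `L` has the entries
`conj (ε k) / (B i - conj (B k))`, and `R = H diag(ε)` with `H k l = 1 / (w k - conj (w l))`.
Schur complements and a diagonal conjugation give `det M = det (1 - L R)` (`det_matM`) and
`det K_j = det M * ρ X` for a row `ρ` (`det_matK`).  The definition of `α` enters through
`cauchyW_mul_sub`: `H k l * (B l - conj (B k))` is the inner product of the polarization vectors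
of the waves `k` and `l`, the columns of `C`, for the signs `s`.

The evolution equation holds for arbitrary polarizations (`colPsi_solves`).  The matrices satisfy
the Sylvester equations `B L - L (conj B) = 1 e` and `R B - (conj B) R = Cᴴ s C diag(ε)`, where `e`
is the row of the `conj (ε k)`, so that the derivatives of `F = 1 - L R` are expressed through `L`
and the right-hand side of the second equation.  With `m = C diag(ε) F⁻¹ L Cᴴ s` one gets
`∂ₓ Ψ = -i (C diag(ε) B X + m Ψ)`.  The decisive identity is `∂ₓ m = -i Ψ Ψᴴ s`
(`colPsi_mul_dual`), which rests on the symmetry between `L R` and `R L` under adjoints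
(`colPsi_conjTranspose`); it turns what remains of `i ∂ₜ Ψ + ∂ₓ² Ψ` into `-2 Ψ Ψᴴ s Ψ`.

For the decay, each wave factor at fixed `t` tends to `0` or to infinity as `x → ± ∞`, since no
`B_l` is real.  Dividing the columns of the block matrix with rows `(1, R)` and `(L, 1)` by the
growing factors leaves a convergent matrix (`balanced`).  Its limit is invertible because the square
blocks of `H` and of `1 / (B i - conj (B k))` at the growing indices are Cauchy matrices with
distinct nodes, and in the limit the scaled solution vanishes at these indices
(`tendsto_colPsi_zero`).
-/

noncomputable section

namespace VectorSoliton

open Matrix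

/-! ### Entrywise calculus of matrix-valued functions -/

/-- Every entry of the matrix-valued function `F` has at `x` the corresponding entry of `F'` as
its derivative.  Working entrywise avoids the choice of a norm on matrices. -/
def HasEntryDerivAt {m n : Type*} (F : ℝ → Matrix m n ℂ) (F' : Matrix m n ℂ) (x : ℝ) : Prop :=
  ∀ i j, HasDerivAt (fun y => F y i j) (F' i j) x

section EntrywiseCalculus

variable {l m n : Type*} {x : ℝ}

theorem hasEntryDerivAt_const (F : Matrix m n ℂ) : HasEntryDerivAt (fun _ => F) 0 x :=
  fun i j => hasDerivAt_const x (F i j)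

theorem HasEntryDerivAt.sub {F G : ℝ → Matrix m n ℂ} {F' G' : Matrix m n ℂ}
    (hF : HasEntryDerivAt F F' x) (hG : HasEntryDerivAt G G' x) :
    HasEntryDerivAt (fun y => F y - G y) (F' - G') x :=
  fun i j => (hF i j).sub (hG i j)

theorem HasEntryDerivAt.add {F G : ℝ → Matrix m n ℂ} {F' G' : Matrix m n ℂ}
    (hF : HasEntryDerivAt F F' x) (hG : HasEntryDerivAt G G' x) :
    HasEntryDerivAt (fun y => F y + G y) (F' + G') x :=
  fun i j => (hF i j).add (hG i j)

theorem HasEntryDerivAt.const_smul {F : ℝ → Matrix m n ℂ} {F' : Matrix m n ℂ}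
    (hF : HasEntryDerivAt F F' x) (c : ℂ) : HasEntryDerivAt (fun y => c • F y) (c • F') x :=
  fun i j => (hF i j).const_mul c

theorem HasEntryDerivAt.mul [Fintype m] {F : ℝ → Matrix l m ℂ} {G : ℝ → Matrix m n ℂ}
    {F' : Matrix l m ℂ} {G' : Matrix m n ℂ}
    (hF : HasEntryDerivAt F F' x) (hG : HasEntryDerivAt G G' x) :
    HasEntryDerivAt (fun y => F y * G y) (F' * G x + F x * G') x := by
  intro i j
  simp only [Matrix.add_apply, Matrix.mul_apply, ← Finset.sum_add_distrib]
  exact HasDerivAt.fun_sum fun k _ => (hF i k).mul (hG k j)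

theorem HasEntryDerivAt.mul_const [Fintype m] {F : ℝ → Matrix l m ℂ} {F' : Matrix l m ℂ}
    (hF : HasEntryDerivAt F F' x) (G : Matrix m n ℂ) :
    HasEntryDerivAt (fun y => F y * G) (F' * G) x := by
  simpa using hF.mul (hasEntryDerivAt_const G)

theorem HasEntryDerivAt.congr_deriv {F : ℝ → Matrix m n ℂ} {F' G' : Matrix m n ℂ}
    (hF : HasEntryDerivAt F F' x) (h : F' = G') : HasEntryDerivAt F G' x := h ▸ hF

theorem HasEntryDerivAt.congr_of_eventuallyEq {F G : ℝ → Matrix m n ℂ} {F' : Matrix m n ℂ}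
    (hF : HasEntryDerivAt F F' x) (h : ∀ᶠ y in nhds x, G y = F y) : HasEntryDerivAt G F' x :=
  fun i j => (hF i j).congr_of_eventuallyEq (h.mono fun y hy => by simp only [hy])

variable [Fintype n] [DecidableEq n]

theorem _root_.ContDiffOn.matrix_det {E : Type*} [NormedAddCommGroup E] [NormedSpace ℝ E]
    {s : Set E} {k : WithTop ℕ∞} {F : E → Matrix n n ℂ}
    (hF : ∀ i j, ContDiffOn ℝ k (fun y => F y i j) s) : ContDiffOn ℝ k (fun y => (F y).det) s := by
  simp only [Matrix.det_apply']
  exact ContDiffOn.sum fun σ _ => contDiffOn_const.mul (contDiffOn_prod fun i _ => hF _ _)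

theorem _root_.ContDiffOn.matrix_inv {E : Type*} [NormedAddCommGroup E] [NormedSpace ℝ E]
    {s : Set E} {k : WithTop ℕ∞} {F : E → Matrix n n ℂ}
    (hF : ∀ i j, ContDiffOn ℝ k (fun y => F y i j) s) (hs : ∀ y ∈ s, (F y).det ≠ 0) (i j : n) :
    ContDiffOn ℝ k (fun y => (F y)⁻¹ i j) s := by
  simp only [Matrix.inv_def, Matrix.smul_apply, Ring.inverse_eq_inv', smul_eq_mul,
    Matrix.adjugate_apply]
  refine ((ContDiffOn.matrix_det hF).inv hs).mul (ContDiffOn.matrix_det fun a b => ?_)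
  by_cases h : a = j
  · subst h; simpa using contDiffOn_const
  · simpa [Matrix.updateRow_ne h] using hF a b

theorem HasEntryDerivAt.differentiableAt_det {F : ℝ → Matrix n n ℂ} {F' : Matrix n n ℂ}
    (hF : HasEntryDerivAt F F' x) : DifferentiableAt ℝ (fun y => (F y).det) x := by
  simp only [Matrix.det_apply']
  exact DifferentiableAt.fun_sum fun σ _ => (differentiableAt_const _).mul
    (DifferentiableAt.fun_finsetProd fun i _ => (hF _ _).differentiableAt)

theorem HasEntryDerivAt.eventually_det_ne_zero {F : ℝ → Matrix n n ℂ} {F' : Matrix n n ℂ}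
    (hF : HasEntryDerivAt F F' x) (h : (F x).det ≠ 0) : ∀ᶠ y in nhds x, (F y).det ≠ 0 :=
  hF.differentiableAt_det.continuousAt.eventually_ne h

/-- Differentiability of the entries of the inverse comes from Cramer's rule; the value of the
derivative then comes from differentiating `F * F⁻¹ = 1`. -/
theorem HasEntryDerivAt.inv {F : ℝ → Matrix n n ℂ} {F' : Matrix n n ℂ}
    (hF : HasEntryDerivAt F F' x) (h : (F x).det ≠ 0) :
    HasEntryDerivAt (fun y => (F y)⁻¹) (-((F x)⁻¹ * F' * (F x)⁻¹)) x := by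
  have hd : ∀ i j, DifferentiableAt ℝ (fun y => (F y)⁻¹ i j) x := by
    intro i j
    simp only [Matrix.inv_def, Matrix.smul_apply, Ring.inverse_eq_inv', smul_eq_mul,
      Matrix.adjugate_apply]
    refine (hF.differentiableAt_det.inv h).mul ?_
    refine HasEntryDerivAt.differentiableAt_det (F := fun y => (F y).updateRow j (Pi.single i 1))
      (F' := F'.updateRow j 0) fun a b => ?_
    by_cases hc : a = j
    · subst hc; simpa using hasDerivAt_const _ _
    · simpa [Matrix.updateRow_ne hc] using hF a b
  set P' : Matrix n n ℂ := Matrix.of fun i j => deriv (fun y => (F y)⁻¹ i j) x with hP'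
  have hP : HasEntryDerivAt (fun y => (F y)⁻¹) P' x := fun i j => (hd i j).hasDerivAt
  have h1 : F' * (F x)⁻¹ + F x * P' = 0 := by
    have e1 := hF.mul hP
    have e2 : HasEntryDerivAt (fun y => F y * (F y)⁻¹) 0 x :=
      (hasEntryDerivAt_const (1 : Matrix n n ℂ)).congr_of_eventuallyEq
        ((hF.eventually_det_ne_zero h).mono fun y hy =>
          Matrix.mul_nonsing_inv _ (isUnit_iff_ne_zero.2 hy))
    ext i j
    exact (e1 i j).unique (e2 i j)
  refine hP.congr_deriv ?_
  have h2 : (F x)⁻¹ * (F' * (F x)⁻¹ + F x * P') = 0 := by rw [h1, Matrix.mul_zero]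
  rw [Matrix.mul_add, ← Matrix.mul_assoc, ← Matrix.mul_assoc,
    Matrix.nonsing_inv_mul _ (isUnit_iff_ne_zero.2 h), Matrix.one_mul] at h2
  exact eq_neg_of_add_eq_zero_right h2

end EntrywiseCalculus

/-! ### Algebra of the Cauchy-type matrices -/

section Algebra

variable {ι κ : Type*} [Fintype ι] [DecidableEq ι]

/-- The Cauchy-type matrix `L i k = conj (ε k) / (B i - conj (B k))` with wave numbers `B` and
wave factors `ε`. -/
def matL (B ε : ι → ℂ) : Matrix ι ι ℂ := Matrix.of fun i k => conj (ε k) / (B i - conj (B k))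

/-- The matrix `R = H diag(ε)`.  In the applications `H` is a skew-Hermitian matrix such that
`H k l * (B l - conj (B k))` is an indefinite inner product of polarization vectors. -/
def matR (H : Matrix ι ι ℂ) (ε : ι → ℂ) : Matrix ι ι ℂ := H * Matrix.diagonal ε

/-- The matrix `F = 1 - L R` of the linear system that is solved to obtain a soliton. -/
def matF (B : ι → ℂ) (H : Matrix ι ι ℂ) (ε : ι → ℂ) : Matrix ι ι ℂ := 1 - matL B ε * matR H ε

/-- The column all of whose entries are `1`. -/
def colOne (ι : Type*) : Matrix ι Unit ℂ := Matrix.of fun _ _ => 1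

/-- The solution `X = F⁻¹ 1` of the linear system `F X = 1`; meaningful if `det F ≠ 0`. -/
def colX (B : ι → ℂ) (H : Matrix ι ι ℂ) (ε : ι → ℂ) : Matrix ι Unit ℂ :=
  (matF B H ε)⁻¹ * colOne ι

/-- The column `Ψ = C diag(ε) X` of soliton components, whose polarization vectors are the columns
of `C`. -/
def colPsi (B : ι → ℂ) (H : Matrix ι ι ℂ) (C : Matrix κ ι ℂ) (ε : ι → ℂ) : Matrix κ Unit ℂ :=
  C * Matrix.diagonal ε * colX B H ε

/-- With `e` the row of the `conj (ε k)`, `Ψᴴ = e (1 - R L)⁻¹ Cᴴ`; the inverse is written as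
`1 + R F⁻¹ L`.  The reason is that `L` and `R` are skew-Hermitian matrices times `diag(conj ε)` and
`diag(ε)`, so that taking adjoints exchanges `L R` and `R L`. -/
theorem colPsi_conjTranspose {B : ι → ℂ} {H : Matrix ι ι ℂ} (hHH : Hᴴ = -H)
    (C : Matrix κ ι ℂ) (ε : ι → ℂ) (hdet : (matF B H ε).det ≠ 0) :
    (colPsi B H C ε)ᴴ = (colOne ι)ᴴ * (Matrix.diagonal (fun k => conj (ε k)) *
      ((1 + matR H ε * (matF B H ε)⁻¹ * matL B ε) * Cᴴ)) := by
  set F := matF B H ε with hF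
  set L := matL B ε with hL
  set R := matR H ε with hR
  set E : Matrix ι ι ℂ := Matrix.diagonal fun k => conj (ε k) with hE
  have hP : F * F⁻¹ = 1 := Matrix.mul_nonsing_inv _ (isUnit_iff_ne_zero.2 hdet)
  have hEE : (Matrix.diagonal ε)ᴴ = E := by
    rw [Matrix.diagonal_conjTranspose]; rfl
  have hEE' : Eᴴ = Matrix.diagonal ε := by rw [← hEE, Matrix.conjTranspose_conjTranspose]
  -- `Z` is the skew-Hermitian Cauchy matrix with `L = Z E`.
  obtain ⟨Z, hLZ, hZ⟩ : ∃ Z : Matrix ι ι ℂ, L = Z * E ∧ Zᴴ = -Z := by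
    refine ⟨Matrix.of fun i k => (B i - conj (B k))⁻¹, ?_, ?_⟩
    · ext i k; simp [hL, hE, matL, Matrix.mul_diagonal]; ring
    · ext i k
      simp only [Matrix.conjTranspose_apply, Matrix.of_apply, Matrix.neg_apply, RCLike.star_def,
        map_inv₀, map_sub, Complex.conj_conj, ← inv_neg, neg_sub]
  have hFE : Fᴴ * E = E * (1 - R * L) := by
    have h1 : Fᴴ = 1 - E * H * (Matrix.diagonal ε * Z) := by
      simp only [hF, matF, ← hL, ← hR, hLZ, Matrix.conjTranspose_sub, Matrix.conjTranspose_one,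
        Matrix.conjTranspose_mul, hZ, hEE']
      simp [hR, matR, hHH, hEE, Matrix.conjTranspose_mul, Matrix.mul_assoc]
    rw [h1, hLZ, hR, matR]
    noncomm_ring
  have hinv : (1 - R * L) * (1 + R * F⁻¹ * L) = 1 := by
    have h2 : F⁻¹ = 1 + L * R * F⁻¹ := by
      have h3 : (1 - L * R) * F⁻¹ = 1 := hP
      rw [sub_mul, one_mul] at h3
      exact sub_eq_iff_eq_add.1 h3
    have : (1 - R * L) * (1 + R * F⁻¹ * L) = 1 + R * (F⁻¹ - (1 + L * R * F⁻¹)) * L := by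
      noncomm_ring
    rw [this, ← h2]; simp
  have hkey : (F⁻¹)ᴴ * E = E * (1 + R * F⁻¹ * L) := by
    have h4 : (F⁻¹)ᴴ * Fᴴ = 1 := by rw [← Matrix.conjTranspose_mul, hP, Matrix.conjTranspose_one]
    calc (F⁻¹)ᴴ * E = (F⁻¹)ᴴ * E * ((1 - R * L) * (1 + R * F⁻¹ * L)) := by rw [hinv, mul_one]
      _ = (F⁻¹)ᴴ * (E * (1 - R * L)) * (1 + R * F⁻¹ * L) := by simp only [mul_assoc]
      _ = (F⁻¹)ᴴ * Fᴴ * E * (1 + R * F⁻¹ * L) := by rw [← hFE]; simp only [mul_assoc]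
      _ = _ := by rw [h4, one_mul]
  simp only [colPsi, colX, Matrix.conjTranspose_mul, hEE, ← hF]
  rw [Matrix.mul_assoc, ← Matrix.mul_assoc _ E, hkey]
  simp only [Matrix.mul_assoc]

theorem matF_apply (B : ι → ℂ) (H : Matrix ι ι ℂ) (ε : ι → ℂ) (i k : ι) :
    matF B H ε i k = (1 : Matrix ι ι ℂ) i k
      - ∑ m, conj (ε m) / (B i - conj (B m)) * (H m k * ε k) := by
  rw [matF, Matrix.sub_apply, Matrix.mul_apply]
  congr 1
  exact Finset.sum_congr rfl fun m _ => by rw [matR, Matrix.mul_diagonal]; rfl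

theorem colX_apply (B : ι → ℂ) (H : Matrix ι ι ℂ) (ε : ι → ℂ) (l : ι) :
    colX B H ε l () = ∑ m, (matF B H ε)⁻¹ l m := by
  rw [colX, Matrix.mul_apply]
  exact Finset.sum_congr rfl fun m _ => mul_one _

theorem colPsi_apply (B : ι → ℂ) (H : Matrix ι ι ℂ) (C : Matrix κ ι ℂ) (ε : ι → ℂ) (j : κ) :
    colPsi B H C ε j () = ∑ l, C j l * ε l * colX B H ε l () := by
  rw [colPsi, Matrix.mul_apply]
  exact Finset.sum_congr rfl fun l _ => by rw [Matrix.mul_diagonal]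

variable [Fintype κ] [DecidableEq κ]

/-- The adjoint `Cᴴ diag(s)` of `C` for the indefinite inner product with signs `s`. -/
def dualC (s : κ → ℝ) (C : Matrix κ ι ℂ) : Matrix ι κ ℂ :=
  Cᴴ * Matrix.diagonal fun j => (s j : ℂ)

/-- The matrix `m = C diag(ε) F⁻¹ L Cᴴ diag(s)`, which satisfies `∂ₓ m = -i Ψ Ψᴴ diag(s)` and so
produces the cubic term. -/
def cubicKernel (B : ι → ℂ) (H : Matrix ι ι ℂ) (s : κ → ℝ) (C : Matrix κ ι ℂ) (ε : ι → ℂ) :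
    Matrix κ κ ℂ :=
  C * Matrix.diagonal ε * ((matF B H ε)⁻¹ * (matL B ε * dualC s C))

/-- The Sylvester equation `B L - L (conj B) = 1 e`, with `e` the row of the `conj (ε k)`: the
commutator has rank one. -/
theorem diagonal_mul_matL {B : ι → ℂ} (hB : ∀ i k, B i ≠ conj (B k)) (ε : ι → ℂ) :
    Matrix.diagonal B * matL B ε = matL B ε * Matrix.diagonal (fun k => conj (B k))
      + colOne ι * ((colOne ι)ᴴ * Matrix.diagonal fun k => conj (ε k)) := by
  ext i k
  have := sub_ne_zero.2 (hB i k)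
  simp [matL, Matrix.diagonal_mul, Matrix.mul_diagonal, colOne, Matrix.mul_apply (m := Unit)]
  field_simp
  ring

/-- The Sylvester equation for `R`. -/
theorem matR_mul_diagonal {B : ι → ℂ} {H : Matrix ι ι ℂ} {s : κ → ℝ} {C : Matrix κ ι ℂ}
    (hH : ∀ k l, H k l * (B l - conj (B k)) = ∑ j, s j * (conj (C j k) * C j l)) (ε : ι → ℂ) :
    matR H ε * Matrix.diagonal B = Matrix.diagonal (fun k => conj (B k)) * matR H ε
      + dualC s C * (C * Matrix.diagonal ε) := by
  ext k l
  have := hH k l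
  rw [← Matrix.mul_assoc (dualC s C)]
  simp only [matR, dualC, Matrix.add_apply, Matrix.mul_diagonal, Matrix.diagonal_mul]
  have e : (Cᴴ * Matrix.diagonal (fun j => (s j : ℂ)) * C) k l
      = ∑ j, s j * (conj (C j k) * C j l) := by
    rw [Matrix.mul_apply]
    refine Finset.sum_congr rfl fun j _ => ?_
    rw [Matrix.mul_diagonal, Matrix.conjTranspose_apply, RCLike.star_def]
    ring
  rw [e, ← this]; ring

/-- The algebraic form of `∂ₓ m = -i Ψ Ψᴴ diag(s)`: the two Sylvester equations give the commutator
of `diag(B)` with `F⁻¹`, and the rank-one term of the first one factors out. -/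
theorem colPsi_mul_dual {B : ι → ℂ} (hB : ∀ i k, B i ≠ conj (B k))
    {H : Matrix ι ι ℂ} (hHH : Hᴴ = -H) {s : κ → ℝ} {C : Matrix κ ι ℂ}
    (hH : ∀ k l, H k l * (B l - conj (B k)) = ∑ j, s j * (conj (C j k) * C j l)) (ε : ι → ℂ)
    (hdet : (matF B H ε).det ≠ 0) :
    C * Matrix.diagonal ε * (Matrix.diagonal B * ((matF B H ε)⁻¹ * (matL B ε * dualC s C)))
      + cubicKernel B H s C ε * cubicKernel B H s C ε
      - C * Matrix.diagonal ε * ((matF B H ε)⁻¹ * (matL B ε *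
        (Matrix.diagonal (fun k => conj (B k)) * dualC s C)))
    = colPsi B H C ε * (colPsi B H C ε)ᴴ * Matrix.diagonal fun j => (s j : ℂ) := by
  rw [colPsi_conjTranspose hHH C ε hdet]
  have hL := diagonal_mul_matL hB ε
  have hR := matR_mul_diagonal hH ε
  simp only [cubicKernel, colPsi, colX]
  have hFd : matF B H ε = 1 - matL B ε * matR H ε := rfl
  set F := matF B H ε
  set L := matL B ε
  set R := matR H ε
  set Φ := C * Matrix.diagonal ε
  set D := Matrix.diagonal B
  set A := Matrix.diagonal fun k => conj (B k)
  set E : Matrix ι ι ℂ := Matrix.diagonal fun k => conj (ε k)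
  set c := dualC s C with hc
  have hP : F * F⁻¹ = 1 := Matrix.mul_nonsing_inv _ (isUnit_iff_ne_zero.2 hdet)
  have hP' : F⁻¹ * F = 1 := Matrix.nonsing_inv_mul _ (isUnit_iff_ne_zero.2 hdet)
  -- the rank-one term
  set U : Matrix ι ι ℂ := colOne ι * ((colOne ι)ᴴ * E) with hU
  -- the commutators of `D` with `F` and with `F⁻¹`
  have hDF : D * F = F * D + L * (c * Φ) - U * R := by
    have : D * F = D - (D * L) * R := by rw [hFd]; noncomm_ring
    rw [this, hL, hFd]
    have h5 : A * R = R * D - c * Φ := by rw [hR]; noncomm_ring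
    have : (L * A + U) * R = L * (A * R) + U * R := by noncomm_ring
    rw [this, h5]; noncomm_ring
  have hPD : D * F⁻¹ = F⁻¹ * D - F⁻¹ * (L * (c * Φ)) * F⁻¹ + F⁻¹ * U * R * F⁻¹ := by
    have h6 : F⁻¹ * (D * F) * F⁻¹ = F⁻¹ * D := by
      rw [mul_assoc, mul_assoc, hP, mul_one]
    have h7 : F⁻¹ * (F * D + L * (c * Φ) - U * R) * F⁻¹
        = F⁻¹ * F * D * F⁻¹ + F⁻¹ * (L * (c * Φ)) * F⁻¹ - F⁻¹ * U * R * F⁻¹ := by noncomm_ring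
    rw [hDF, h7, hP', one_mul] at h6
    rw [← h6]; abel
  have hmain : D * F⁻¹ * L + F⁻¹ * (L * (c * Φ)) * F⁻¹ * L - F⁻¹ * L * A
      = F⁻¹ * U * (1 + R * F⁻¹ * L) := by
    have : F⁻¹ * L * A = F⁻¹ * (D * L) - F⁻¹ * U := by rw [hL]; noncomm_ring
    rw [this, hPD]; noncomm_ring
  have := congrArg (fun T => Φ * (T * c)) hmain
  simp only [Matrix.add_mul, Matrix.sub_mul, Matrix.mul_add, Matrix.mul_sub,
    Matrix.mul_assoc] at this
  simp only [Matrix.mul_assoc]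
  rw [this, hU]
  simp only [hc, dualC, Matrix.add_mul, Matrix.mul_add, Matrix.one_mul, Matrix.mul_assoc]

end Algebra

/-! ### Derivatives along curves of wave factors -/

section Evolution

variable {ι κ : Type*} [Fintype ι] [DecidableEq ι]
  {B b : ι → ℂ} {H : Matrix ι ι ℂ} {s : κ → ℝ} {C : Matrix κ ι ℂ} {ε : ℝ → ι → ℂ} {x : ℝ}

theorem hasEntryDerivAt_mul_diagonal {κ : Type*} (C : Matrix κ ι ℂ)
    (hε : ∀ l, HasDerivAt (fun y => ε y l) (-Complex.I * (b l * ε x l)) x) :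
    HasEntryDerivAt (fun y => C * Matrix.diagonal (ε y))
      (-Complex.I • (C * Matrix.diagonal (ε x) * Matrix.diagonal b)) x := by
  intro i l
  simp only [Matrix.mul_diagonal, Matrix.smul_apply, smul_eq_mul]
  exact ((hε l).const_mul (C i l)).congr_deriv (by ring)

theorem hasEntryDerivAt_matL
    (hε : ∀ l, HasDerivAt (fun y => ε y l) (-Complex.I * (b l * ε x l)) x) :
    HasEntryDerivAt (fun y => matL B (ε y))
      (Complex.I • (matL B (ε x) * Matrix.diagonal fun k => conj (b k))) x := by
  intro i l
  simp only [Matrix.mul_diagonal, Matrix.smul_apply, smul_eq_mul, matL, Matrix.of_apply]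
  refine ((hε l).star.div_const _).congr_deriv ?_
  simp only [RCLike.star_def, map_mul, map_neg, Complex.conj_I]
  ring

/-- If the wave factors satisfy `ε' = -i b ε`, then `F' = i L Q`, where `Q = R b - (conj b) R`.
It is used with `b = B` for the derivative in `x` and `b = B²` for the one in `t`. -/
theorem hasEntryDerivAt_matF {Q : Matrix ι ι ℂ}
    (hε : ∀ l, HasDerivAt (fun y => ε y l) (-Complex.I * (b l * ε x l)) x)
    (hQ : matR H (ε x) * Matrix.diagonal b
      = Matrix.diagonal (fun k => conj (b k)) * matR H (ε x) + Q) :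
    HasEntryDerivAt (fun y => matF B H (ε y)) (Complex.I • (matL B (ε x) * Q)) x := by
  refine ((hasEntryDerivAt_const 1).sub ((hasEntryDerivAt_matL hε).mul
    (hasEntryDerivAt_mul_diagonal H hε))).congr_deriv ?_
  change 0 - (Complex.I • (matL B (ε x) * _) * matR H (ε x) +
    matL B (ε x) * (-Complex.I • (matR H (ε x) * _))) = _
  rw [hQ]
  simp only [Matrix.smul_mul, Matrix.mul_smul, Matrix.mul_add, Matrix.mul_assoc]
  module

theorem hasEntryDerivAt_colX {Q : Matrix ι ι ℂ}
    (hε : ∀ l, HasDerivAt (fun y => ε y l) (-Complex.I * (b l * ε x l)) x)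
    (hQ : matR H (ε x) * Matrix.diagonal b
      = Matrix.diagonal (fun k => conj (b k)) * matR H (ε x) + Q)
    (hdet : (matF B H (ε x)).det ≠ 0) :
    HasEntryDerivAt (fun y => colX B H (ε y))
      (-Complex.I • ((matF B H (ε x))⁻¹ * (matL B (ε x) * (Q * colX B H (ε x))))) x := by
  refine (((hasEntryDerivAt_matF hε hQ).inv hdet).mul_const (colOne ι)).congr_deriv ?_
  simp only [Matrix.smul_mul, Matrix.mul_smul, Matrix.mul_assoc, colX, Matrix.neg_mul, neg_smul]

theorem hasEntryDerivAt_colPsi {Q : Matrix ι ι ℂ}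
    (hε : ∀ l, HasDerivAt (fun y => ε y l) (-Complex.I * (b l * ε x l)) x)
    (hQ : matR H (ε x) * Matrix.diagonal b
      = Matrix.diagonal (fun k => conj (b k)) * matR H (ε x) + Q)
    (hdet : (matF B H (ε x)).det ≠ 0) :
    HasEntryDerivAt (fun y => colPsi B H C (ε y))
      (-Complex.I • (C * Matrix.diagonal (ε x) * (Matrix.diagonal b * colX B H (ε x))
        + C * Matrix.diagonal (ε x) *
          ((matF B H (ε x))⁻¹ * (matL B (ε x) * (Q * colX B H (ε x)))))) x := by
  refine ((hasEntryDerivAt_mul_diagonal C hε).mul (hasEntryDerivAt_colX hε hQ hdet)).congr_deriv ?_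
  simp only [Matrix.smul_mul, Matrix.mul_smul, Matrix.mul_assoc, smul_add]

variable [Fintype κ] [DecidableEq κ]

/-- The space derivative `∂ₓ Ψ = -i (C ε B X + m Ψ)`. -/
theorem hasEntryDerivAt_colPsi_fst
    (hH : ∀ k l, H k l * (B l - conj (B k)) = ∑ j, s j * (conj (C j k) * C j l))
    (hε : ∀ l, HasDerivAt (fun y => ε y l) (-Complex.I * (B l * ε x l)) x)
    (hdet : (matF B H (ε x)).det ≠ 0) :
    HasEntryDerivAt (fun y => colPsi B H C (ε y))
      (-Complex.I • (C * Matrix.diagonal (ε x) * (Matrix.diagonal B * colX B H (ε x))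
        + cubicKernel B H s C (ε x) * colPsi B H C (ε x))) x := by
  refine (hasEntryDerivAt_colPsi hε (matR_mul_diagonal hH (ε x)) hdet).congr_deriv ?_
  simp only [cubicKernel, colPsi, Matrix.mul_assoc]

theorem hasEntryDerivAt_cubicKernel (hB : ∀ i k, B i ≠ conj (B k)) (hHH : Hᴴ = -H)
    (hH : ∀ k l, H k l * (B l - conj (B k)) = ∑ j, s j * (conj (C j k) * C j l))
    (hε : ∀ l, HasDerivAt (fun y => ε y l) (-Complex.I * (B l * ε x l)) x)
    (hdet : (matF B H (ε x)).det ≠ 0) :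
    HasEntryDerivAt (fun y => cubicKernel B H s C (ε y))
      (-Complex.I • (colPsi B H C (ε x) * (colPsi B H C (ε x))ᴴ *
        Matrix.diagonal fun j => (s j : ℂ))) x := by
  refine ((hasEntryDerivAt_mul_diagonal C hε).mul
    (((hasEntryDerivAt_matF hε (matR_mul_diagonal hH (ε x))).inv hdet).mul
      ((hasEntryDerivAt_matL hε).mul_const (dualC s C)))).congr_deriv ?_
  rw [← colPsi_mul_dual hB hHH hH (ε x) hdet]
  simp only [cubicKernel, Matrix.smul_mul, Matrix.mul_smul, Matrix.mul_assoc, Matrix.neg_mul,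
    Matrix.mul_add, Matrix.mul_neg]
  module

/-- The second space derivative of `Ψ`, as the derivative of the formula for the first one. -/
theorem hasEntryDerivAt_deriv_colPsi (hB : ∀ i k, B i ≠ conj (B k)) (hHH : Hᴴ = -H)
    (hH : ∀ k l, H k l * (B l - conj (B k)) = ∑ j, s j * (conj (C j k) * C j l))
    (hε : ∀ l, HasDerivAt (fun y => ε y l) (-Complex.I * (B l * ε x l)) x)
    (hdet : (matF B H (ε x)).det ≠ 0) :
    HasEntryDerivAt (fun y => -Complex.I •
      (C * Matrix.diagonal (ε y) * (Matrix.diagonal B * colX B H (ε y))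
        + cubicKernel B H s C (ε y) * colPsi B H C (ε y)))
      (-(C * Matrix.diagonal (ε x) * (Matrix.diagonal B * (Matrix.diagonal B * colX B H (ε x)))
        + C * Matrix.diagonal (ε x) * (Matrix.diagonal B * ((matF B H (ε x))⁻¹ *
          (matL B (ε x) * (dualC s C * colPsi B H C (ε x)))))
        + colPsi B H C (ε x) * (colPsi B H C (ε x))ᴴ * Matrix.diagonal (fun j => (s j : ℂ))
          * colPsi B H C (ε x)
        + cubicKernel B H s C (ε x) *
          (C * Matrix.diagonal (ε x) * (Matrix.diagonal B * colX B H (ε x))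
          + cubicKernel B H s C (ε x) * colPsi B H C (ε x)))) x := by
  have h1 := ((hasEntryDerivAt_mul_diagonal C hε).mul
    ((hasEntryDerivAt_const (Matrix.diagonal B)).mul
      (hasEntryDerivAt_colX hε (matR_mul_diagonal hH (ε x)) hdet))).add
    ((hasEntryDerivAt_cubicKernel hB hHH hH hε hdet).mul (hasEntryDerivAt_colPsi_fst hH hε hdet))
  refine (h1.const_smul (-Complex.I)).congr_deriv ?_
  have hI : ∀ T : Matrix κ Unit ℂ, -Complex.I • (-Complex.I • T) = -T := fun T => by
    rw [smul_smul]; simp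
  rw [← hI]
  congr 1
  simp only [colPsi, Matrix.smul_mul, Matrix.mul_smul, Matrix.mul_assoc, Matrix.mul_add,
    Matrix.zero_mul, zero_add]
  module

/-- The time derivative of `Ψ`; here `Q = R B² - (conj B)² R` is expressed through the commutator of
first order. -/
theorem hasEntryDerivAt_colPsi_snd
    (hH : ∀ k l, H k l * (B l - conj (B k)) = ∑ j, s j * (conj (C j k) * C j l))
    (hε : ∀ l, HasDerivAt (fun y => ε y l) (-Complex.I * (B l ^ 2 * ε x l)) x)
    (hdet : (matF B H (ε x)).det ≠ 0) :
    HasEntryDerivAt (fun y => colPsi B H C (ε y))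
      (-Complex.I • (
        C * Matrix.diagonal (ε x) * (Matrix.diagonal B * (Matrix.diagonal B * colX B H (ε x)))
        + C * Matrix.diagonal (ε x) * ((matF B H (ε x))⁻¹ * (matL B (ε x) *
          (Matrix.diagonal (fun k => conj (B k)) * (dualC s C * colPsi B H C (ε x)))))
        + cubicKernel B H s C (ε x) *
          (C * Matrix.diagonal (ε x) * (Matrix.diagonal B * colX B H (ε x))))) x := by
  have hQ := matR_mul_diagonal hH (ε x)
  have hD : Matrix.diagonal (fun l => B l ^ 2) = Matrix.diagonal B * Matrix.diagonal B := by
    rw [Matrix.diagonal_mul_diagonal]; simp only [pow_two]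
  have hA : Matrix.diagonal (fun l => conj (B l ^ 2))
      = Matrix.diagonal (fun k => conj (B k)) * Matrix.diagonal fun k => conj (B k) := by
    rw [Matrix.diagonal_mul_diagonal]; simp only [pow_two, map_mul]
  have hQ2 : matR H (ε x) * Matrix.diagonal (fun l => B l ^ 2)
      = Matrix.diagonal (fun l => conj (B l ^ 2)) * matR H (ε x)
        + (Matrix.diagonal (fun k => conj (B k)) * (dualC s C * (C * Matrix.diagonal (ε x)))
          + dualC s C * (C * Matrix.diagonal (ε x)) * Matrix.diagonal B) := by
    rw [hD, hA, ← mul_assoc, hQ, add_mul, mul_assoc _ (matR H (ε x)), hQ]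
    noncomm_ring
  refine (hasEntryDerivAt_colPsi hε hQ2 hdet).congr_deriv ?_
  rw [hD]
  simp only [cubicKernel, colPsi, Matrix.mul_assoc, Matrix.mul_add, Matrix.add_mul]
  congr 1
  abel

/-- The nonlinear Schrödinger equation for the column `Ψ`, with the two derivatives inserted. -/
theorem colPsi_evolution (hB : ∀ i k, B i ≠ conj (B k)) (hHH : Hᴴ = -H)
    (hH : ∀ k l, H k l * (B l - conj (B k)) = ∑ j, s j * (conj (C j k) * C j l)) (ε : ι → ℂ)
    (hdet : (matF B H ε).det ≠ 0) :
    Complex.I • (-Complex.I • (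
        C * Matrix.diagonal ε * (Matrix.diagonal B * (Matrix.diagonal B * colX B H ε))
        + C * Matrix.diagonal ε * ((matF B H ε)⁻¹ * (matL B ε *
          (Matrix.diagonal (fun k => conj (B k)) * (dualC s C * colPsi B H C ε))))
        + cubicKernel B H s C ε * (C * Matrix.diagonal ε * (Matrix.diagonal B * colX B H ε))))
      + -(C * Matrix.diagonal ε * (Matrix.diagonal B * (Matrix.diagonal B * colX B H ε))
        + C * Matrix.diagonal ε * (Matrix.diagonal B * ((matF B H ε)⁻¹ *
          (matL B ε * (dualC s C * colPsi B H C ε))))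
        + colPsi B H C ε * (colPsi B H C ε)ᴴ * Matrix.diagonal (fun j => (s j : ℂ))
          * colPsi B H C ε
        + cubicKernel B H s C ε * (C * Matrix.diagonal ε * (Matrix.diagonal B * colX B H ε)
          + cubicKernel B H s C ε * colPsi B H C ε))
      + (2 : ℂ) • (colPsi B H C ε * (colPsi B H C ε)ᴴ * Matrix.diagonal (fun j => (s j : ℂ))
          * colPsi B H C ε) = 0 := by
  have h := congrArg (· * colPsi B H C ε) (colPsi_mul_dual hB hHH hH ε hdet)
  simp only [Matrix.add_mul, Matrix.sub_mul] at h
  rw [← h]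
  have hI : ∀ T : Matrix κ Unit ℂ, Complex.I • (-Complex.I • T) = T := fun T => by
    rw [smul_smul]; simp
  rw [hI]
  simp only [Matrix.mul_add, Matrix.mul_assoc]
  module

end Evolution

/-! ### Vector solitons solve the nonlinear Schrödinger system -/

section Solution

variable {ι κ : Type*}

/-- The plane waves `c_l exp(-i B_l x - i B_l² t)` solving the linear Schrödinger equation. -/
def wave (B c : ι → ℂ) (x t : ℝ) (l : ι) : ℂ :=
  c l * Complex.exp (-Complex.I * (B l * x + B l ^ 2 * t))

theorem hasDerivAt_wave_fst (B c : ι → ℂ) (x t : ℝ) (l : ι) :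
    HasDerivAt (fun y => wave B c y t l) (-Complex.I * (B l * wave B c x t l)) x := by
  have h : HasDerivAt (fun y : ℝ => -Complex.I * (B l * (y : ℂ) + B l ^ 2 * t))
      (-Complex.I * (B l * 1)) x :=
    ((Complex.ofRealCLM.hasDerivAt.const_mul _).add_const _).const_mul _
  exact (h.cexp.const_mul (c l)).congr_deriv (by simp only [wave]; ring)

theorem hasDerivAt_wave_snd (B c : ι → ℂ) (x t : ℝ) (l : ι) :
    HasDerivAt (fun τ => wave B c x τ l) (-Complex.I * (B l ^ 2 * wave B c x t l)) t := by
  have h : HasDerivAt (fun τ : ℝ => -Complex.I * (B l * (x : ℂ) + B l ^ 2 * τ))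
      (-Complex.I * (B l ^ 2 * 1)) t :=
    ((Complex.ofRealCLM.hasDerivAt.const_mul _).const_add _).const_mul _
  exact (h.cexp.const_mul (c l)).congr_deriv (by simp only [wave]; ring)

theorem contDiff_wave (B c : ι → ℂ) (l : ι) :
    ContDiff ℝ ∞ (fun p : ℝ × ℝ => wave B c p.1 p.2 l) := by
  have h1 : ContDiff ℝ ∞ (fun p : ℝ × ℝ => (p.1 : ℂ)) :=
    Complex.ofRealCLM.contDiff.comp contDiff_fst
  have h2 : ContDiff ℝ ∞ (fun p : ℝ × ℝ => (p.2 : ℂ)) :=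
    Complex.ofRealCLM.contDiff.comp contDiff_snd
  unfold wave
  fun_prop

variable [Fintype ι] [DecidableEq ι]

theorem contDiffOn_colPsi (B c : ι → ℂ) (H : Matrix ι ι ℂ) (C : Matrix κ ι ℂ) (j : κ) :
    ContDiffOn ℝ ∞ (fun p : ℝ × ℝ => colPsi B H C (wave B c p.1 p.2) j ())
      {p | (matF B H (wave B c p.1 p.2)).det ≠ 0} := by
  have hw := contDiff_wave B c
  have hwc : ∀ l, ContDiff ℝ ∞ (fun p : ℝ × ℝ => conj (wave B c p.1 p.2 l)) :=
    fun l => Complex.conjCLE.contDiff.comp (hw l)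
  have hF : ∀ i k, ContDiff ℝ ∞ (fun p : ℝ × ℝ => matF B H (wave B c p.1 p.2) i k) := by
    intro i k
    simp only [matF_apply]
    exact contDiff_const.sub (ContDiff.sum fun m _ =>
      ((hwc m).div_const _).mul (contDiff_const.mul (hw k)))
  have hP := ContDiffOn.matrix_inv (fun i k => (hF i k).contDiffOn)
    (s := {p : ℝ × ℝ | (matF B H (wave B c p.1 p.2)).det ≠ 0}) (fun _ hp => hp)
  simp only [colPsi_apply, colX_apply]
  exact ContDiffOn.sum fun l _ => (contDiff_const.mul (hw l)).contDiffOn.mul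
    (ContDiffOn.sum fun m _ => hP l m)

variable [Fintype κ] [DecidableEq κ]

/-- The vector soliton with arbitrary wave numbers `B`, polarizations `C` and signs `s` solves the
nonlinear Schrödinger system wherever `det F ≠ 0`. -/
theorem colPsi_solves {B : ι → ℂ} {H : Matrix ι ι ℂ} {s : κ → ℝ} {C : Matrix κ ι ℂ}
    (hB : ∀ i k, B i ≠ conj (B k)) (hHH : Hᴴ = -H)
    (hH : ∀ k l, H k l * (B l - conj (B k)) = ∑ j, s j * (conj (C j k) * C j l))
    (c : ι → ℂ) {x t : ℝ} (hdet : (matF B H (wave B c x t)).det ≠ 0) (j : κ) :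
    Complex.I * deriv (fun τ => colPsi B H C (wave B c x τ) j ()) t
      + iteratedDeriv 2 (fun y => colPsi B H C (wave B c y t) j ()) x
      + 2 * ((∑ k, s k * ‖colPsi B H C (wave B c x t) k ()‖ ^ 2 : ℝ) : ℂ)
        * colPsi B H C (wave B c x t) j () = 0 := by
  have hx := fun y => hasDerivAt_wave_fst B c y t
  have h1 : ∀ᶠ y in nhds x, (matF B H (wave B c y t)).det ≠ 0 :=
    (hasEntryDerivAt_matF (hx x) (matR_mul_diagonal hH _)).eventually_det_ne_zero hdet
  have h2 : deriv (fun y => colPsi B H C (wave B c y t) j ()) =ᶠ[nhds x] _ :=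
    h1.mono fun y hy => (hasEntryDerivAt_colPsi_fst hH (hx y) hy j ()).deriv
  rw [iteratedDeriv_succ, iteratedDeriv_one, h2.deriv_eq,
    (hasEntryDerivAt_deriv_colPsi hB hHH hH (hx x) hdet j ()).deriv,
    (hasEntryDerivAt_colPsi_snd hH (hasDerivAt_wave_snd B c x t) hdet j ()).deriv]
  refine Eq.trans ?_ (congrFun (congrFun (colPsi_evolution hB hHH hH (wave B c x t) hdet) j) ())
  simp only [Matrix.add_apply, Matrix.smul_apply, smul_eq_mul, Matrix.neg_apply, mul_assoc]
  congr 2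
  set ψ := colPsi B H C (wave B c x t)
  have hu : (ψ * (ψᴴ * ((Matrix.diagonal fun j => (s j : ℂ)) * ψ))) j ()
      = ψ j () * (ψᴴ * ((Matrix.diagonal fun j => (s j : ℂ)) * ψ)) () () := by
    rw [Matrix.mul_apply]
    exact Fintype.sum_unique (ι := Unit) _
  rw [mul_comm _ (ψ j ()), Matrix.mul_assoc, Matrix.mul_assoc, hu]
  congr 1
  rw [Matrix.mul_apply, Complex.ofReal_sum]
  refine Finset.sum_congr rfl fun k _ => ?_
  rw [Matrix.diagonal_mul, Matrix.conjTranspose_apply, Complex.ofReal_mul, Complex.ofReal_pow,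
    ← Complex.mul_conj', RCLike.star_def]
  change _ = conj (ψ k ()) * (s k * ψ k ())
  ring

end Solution
end VectorSoliton

/-! ### Two determinant evaluations -/

namespace Matrix

variable {ι : Type*} [Fintype ι] [DecidableEq ι]

theorem det_eq_of_forall_eq_mul_div {T F : Matrix ι ι ℂ} (h : ι → ℂ) (hh : ∀ i, h i ≠ 0)
    (hT : ∀ i l, T i l = h i * F i l / h l) : T.det = F.det := by
  have e : T = Matrix.diagonal h * F * Matrix.diagonal fun l => (h l)⁻¹ := by
    ext i l
    rw [Matrix.mul_diagonal, Matrix.diagonal_mul, hT, div_eq_mul_inv]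
  rw [e, Matrix.det_mul, Matrix.det_mul, Matrix.det_diagonal, Matrix.det_diagonal,
    mul_right_comm, ← Finset.prod_mul_distrib]
  simp [hh]

/-- If the row `i₀` of `T` is `ρ` and its other rows are differences `F i - F i₀` up to multiples of
`ρ`, then `det T = det F * ρ F⁻¹ 1`.  After multiplication by `F⁻¹` and removal of the multiples of
the row `i₀`, the rows other than `i₀` are `e i - e i₀`, so that only the sum of the entries of
`ρ F⁻¹` matters. -/
theorem det_of_row_differences {T F : Matrix ι ι ℂ} (i₀ : ι) (ρ g : ι → ℂ) (hF : F.det ≠ 0)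
    (h₀ : ∀ l, T i₀ l = ρ l)
    (hT : ∀ i l, i ≠ i₀ → T i l = F i l - F i₀ l + g i * ρ l) :
    T.det = F.det * ∑ l, ρ l * ∑ m, F⁻¹ l m := by
  set u : ι → ℂ := ρ ᵥ* F⁻¹ with hu
  have hFF : F⁻¹ * F = 1 := Matrix.nonsing_inv_mul _ (isUnit_iff_ne_zero.2 hF)
  have huF : ∀ l, ∑ i, u i * F i l = ρ l := fun l => by
    have : u ᵥ* F = ρ := by rw [hu, Matrix.vecMul_vecMul, hFF, Matrix.vecMul_one]
    exact congrFun this l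
  have hsum : ∑ l, ρ l * ∑ m, F⁻¹ l m = ∑ m, u m := by
    simp only [hu, Matrix.vecMul, dotProduct, Finset.mul_sum]
    exact Finset.sum_comm
  -- the rows `e i - e i₀` and, in position `i₀`, the row `u`
  set S : Matrix ι ι ℂ := Matrix.of fun i l =>
    if i = i₀ then u l else (1 : Matrix ι ι ℂ) i l - (1 : Matrix ι ι ℂ) i₀ l with hS
  have hST : T.det = (S * F).det := by
    refine Matrix.det_eq_of_forall_row_eq_smul_add_const (fun i => if i = i₀ then 0 else g i) i₀
      (if_pos rfl) fun i l => ?_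
    have e₀ : (S * F) i₀ l = ρ l := by
      rw [Matrix.mul_apply, ← huF]; simp [hS]
    by_cases hi : i = i₀
    · subst hi; rw [e₀, h₀]; simp
    · have e1 : (S * F) i l = F i l - F i₀ l := by
        rw [Matrix.mul_apply]
        simp [hS, hi, sub_mul, Finset.sum_sub_distrib, Matrix.one_apply]
      rw [e₀, e1, hT i l hi, if_neg hi]
  -- `W` is unipotent and `S * W⁻¹` differs from `1` in the row `i₀` only
  set W : Matrix ι ι ℂ := Matrix.of fun i l =>
    (1 : Matrix ι ι ℂ) i l + (if i = i₀ then 0 else -1) * (1 : Matrix ι ι ℂ) i₀ l with hW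
  have hWdet : W.det = 1 := by
    rw [← Matrix.det_one (n := ι) (R := ℂ)]
    exact Matrix.det_eq_of_forall_row_eq_smul_add_const (fun i => if i = i₀ then 0 else -1) i₀
      (if_pos rfl) fun i l => rfl
  have hSW : S = (1 : Matrix ι ι ℂ).updateRow i₀ (Function.update u i₀ (∑ m, u m)) * W := by
    ext i l
    rw [Matrix.mul_apply]
    by_cases hi : i = i₀
    · subst hi
      have h1 : ∀ k, Function.update u i (∑ m, u m) k * (if k = i then (0 : ℂ) else -1)
          = (if k = i then u i else 0) - u k := fun k => by
        by_cases hk : k = i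
        · subst hk; simp
        · simp [hk]
      simp only [hS, hW, Matrix.of_apply, if_true, Matrix.updateRow_self, mul_add,
        Finset.sum_add_distrib, ← mul_assoc, ← Finset.sum_mul, h1]
      by_cases hl : l = i
      · subst hl; simp [Matrix.one_apply]
      · simp [Matrix.one_apply, hl, Ne.symm hl]
    · simp only [Matrix.updateRow_ne hi]
      simp [hS, hW, hi, Matrix.one_apply, sub_eq_add_neg, neg_ite]
  rw [hST, Matrix.det_mul, hSW, Matrix.det_mul, hWdet, mul_one, hsum, mul_comm]
  congr 1
  have := Matrix.cramer_transpose_apply (1 : Matrix ι ι ℂ) (Function.update u i₀ (∑ m, u m)) i₀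
  rw [← this]; simp

end Matrix

/-! ### Reduction of the determinant formula to vector solitons -/

namespace BrightSoliton

open VectorSoliton

variable {n N : ℕ} (a γ : Fin n → ℝ) (w d : Fin N → ℂ)

/-- The wave numbers `B k = α_{v_{2k}}`, the conjugates of the `α_{u_{2k-1}}`. -/
def waveNumber (k : Fin N) : ℂ := conj (alpha a γ w k)

/-- The constants `w_{u_{2k}} α_{v_{2k}} e^{-d_{2k}}` of the plane waves
`w_{u_{2k}} α_{v_{2k}} e^{z_{2k}}`. -/
def amplitude (k : Fin N) : ℂ :=
  conj (w k) * conj (alpha a γ w k) * Complex.exp (-conj (d k))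

/-- The Cauchy matrix with entries `1 / (w_{v_{2k-1}} - w_{u_{2l}})`, in the role of `H`. -/
def cauchyW : Matrix (Fin N) (Fin N) ℂ := Matrix.of fun k l => (w k - conj (w l))⁻¹

/-- The polarization vectors; the phase `e^{iθ}` is included in them. -/
def polarization (θ : ℝ) : Matrix (Fin n) (Fin N) ℂ :=
  Matrix.of fun j l => ((Real.sqrt |γ j| / |a j| : ℝ) : ℂ) * Complex.exp (Complex.I * θ)
    * (a j / (a j - conj (w l)))

variable {a γ w d}

theorem sub_ne_zero_of_ne_conj (hw : ∀ k l, w k ≠ conj (w l)) (r : ℝ) (k : Fin N) :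
    (r : ℂ) - w k ≠ 0 := by
  intro h
  apply hw k k
  rw [← sub_eq_zero.1 h, Complex.conj_ofReal]

theorem sub_conj_ne_zero_of_ne_conj (hw : ∀ k l, w k ≠ conj (w l)) (r : ℝ) (k : Fin N) :
    (r : ℂ) - conj (w k) ≠ 0 := by
  intro h
  apply sub_ne_zero_of_ne_conj hw r k
  simpa using congrArg conj h

theorem ne_zero_of_ne_conj {w : Fin N → ℂ} (hw : ∀ k l, w k ≠ conj (w l)) (k : Fin N) :
    w k ≠ 0 := fun h => hw k k (by simp [h])

theorem wave_eq (x t : ℝ) (l : Fin N) :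
    wave (waveNumber a γ w) (amplitude a γ w d) x t l
      = conj (w l) * conj (alpha a γ w l) * Complex.exp (z a γ w d x t (.inr l)) := by
  simp only [wave, amplitude, waveNumber, z, mul_assoc, ← Complex.exp_add]
  congr 3
  simp only [map_sub, map_add, map_mul, map_pow, Complex.conj_I, Complex.conj_ofReal]
  ring

theorem conj_wave_eq (x t : ℝ) (l : Fin N) :
    conj (wave (waveNumber a γ w) (amplitude a γ w d) x t l)
      = w l * alpha a γ w l * Complex.exp (z a γ w d x t (.inl l)) := by
  rw [wave_eq]
  simp only [map_mul, Complex.conj_conj, ← Complex.exp_conj, z]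

theorem cauchyW_conjTranspose (w : Fin N → ℂ) : (cauchyW w).conjTranspose = -cauchyW w := by
  ext k l
  simp only [cauchyW, Matrix.conjTranspose_apply, Matrix.of_apply, Matrix.neg_apply,
    RCLike.star_def, map_inv₀, map_sub, Complex.conj_conj, ← inv_neg, neg_sub]

/-- The only place where the definition of `alpha` enters the evolution equation: the difference
`B l - conj (B k)` is `w k - conj (w l)` times a sum of products, by partial fractions in each
component. -/
theorem cauchyW_mul_sub (θ : ℝ) (ha : ∀ j, a j ≠ 0) (hw : ∀ k l, w k ≠ conj (w l))
    (k l : Fin N) :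
    cauchyW w k l * (waveNumber a γ w l - conj (waveNumber a γ w k))
      = ∑ j, ((SignType.sign (γ j) : ℝ) : ℂ)
          * (conj (polarization a γ w θ j k) * polarization a γ w θ j l) := by
  have hkl := sub_ne_zero.2 (hw k l)
  simp only [cauchyW, waveNumber, Complex.conj_conj, alpha, map_sum, Matrix.of_apply,
    ← Finset.sum_sub_distrib, Finset.mul_sum]
  refine Finset.sum_congr rfl fun j _ => ?_
  have h1 := sub_ne_zero_of_ne_conj hw (a j) k
  have h2 := sub_conj_ne_zero_of_ne_conj hw (a j) l
  have h3 : (a j : ℂ) ≠ 0 := Complex.ofReal_ne_zero.2 (ha j)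
  have hθ : conj (Complex.exp (Complex.I * θ)) * Complex.exp (Complex.I * θ) = 1 := by
    rw [← Complex.exp_conj, ← Complex.exp_add]; simp
  have hs : ((SignType.sign (γ j) : ℝ) : ℂ)
      * ((Real.sqrt |γ j| / |a j| : ℝ) * (Real.sqrt |γ j| / |a j| : ℝ)) = γ j / a j ^ 2 := by
    rw [← Complex.ofReal_mul, ← Complex.ofReal_mul, div_mul_div_comm,
      Real.mul_self_sqrt (abs_nonneg _), abs_mul_abs_self, mul_div_assoc', sign_mul_abs]
    push_cast; ring
  simp only [polarization, Matrix.of_apply, map_mul, map_sub, map_div₀, map_one,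
    Complex.conj_ofReal, Complex.conj_conj]
  trans ((SignType.sign (γ j) : ℝ) : ℂ)
      * ((Real.sqrt |γ j| / |a j| : ℝ) * (Real.sqrt |γ j| / |a j| : ℝ))
      * (conj (Complex.exp (Complex.I * θ)) * Complex.exp (Complex.I * θ))
      * ((a j / (a j - w k)) * (a j / (a j - conj (w l))))
  · rw [hs, hθ]
    field_simp
    ring
  · ring

/-- Taking the Schur complement of the odd block turns `matM` into a matrix that is conjugate to
`matF` by a diagonal matrix; the half exponents disappear with this conjugation. -/
theorem det_matM (hw : ∀ k l, w k ≠ conj (w l))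
    (hα : ∀ k l, alpha a γ w k ≠ conj (alpha a γ w l)) (x t : ℝ) :
    (matM a γ w d x t).det
      = (matF (waveNumber a γ w) (cauchyW w)
          (wave (waveNumber a γ w) (amplitude a γ w d) x t)).det := by
  have e : matM a γ w d x t = Matrix.fromBlocks 1 (matM a γ w d x t).toBlocks₁₂
      (matM a γ w d x t).toBlocks₂₁ 1 := by
    ext (i | i) (k | k) <;> simp [matM, Matrix.one_apply, Matrix.toBlocks₁₂, Matrix.toBlocks₂₁]
  rw [e, Matrix.det_fromBlocks_one₁₁]
  refine Matrix.det_eq_of_forall_eq_mul_div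
    (fun i => conj (alpha a γ w i) * conj (w i) * Complex.exp (1 / 2 * z a γ w d x t (.inr i)))
    (fun i => mul_ne_zero (mul_ne_zero (by simpa using ne_zero_of_ne_conj hα i)
      (by simpa using ne_zero_of_ne_conj hw i)) (Complex.exp_ne_zero _)) fun i l => ?_
  have hBl : conj (alpha a γ w l) ≠ 0 := by simpa using ne_zero_of_ne_conj hα l
  have hVl : conj (w l) ≠ 0 := by simpa using ne_zero_of_ne_conj hw l
  have hBi : conj (alpha a γ w i) ≠ 0 := by simpa using ne_zero_of_ne_conj hα i
  have hVi : conj (w i) ≠ 0 := by simpa using ne_zero_of_ne_conj hw i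
  rw [matF_apply, Matrix.sub_apply, Matrix.mul_apply, mul_sub, sub_div, Finset.mul_sum,
    Finset.sum_div]
  congr 1
  · by_cases h : i = l
    · subst h; field_simp
    · simp [Matrix.one_apply_ne h]
  · refine Finset.sum_congr rfl fun k _ => ?_
    rw [conj_wave_eq, wave_eq]
    have h1 : conj (alpha a γ w i) - alpha a γ w k ≠ 0 := sub_ne_zero.2 (hα k i).symm
    have h2 := sub_ne_zero.2 (hw k l)
    have hsq : ∀ p, Complex.exp (z a γ w d x t p)
        = Complex.exp (1 / 2 * z a γ w d x t p) * Complex.exp (1 / 2 * z a γ w d x t p) := by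
      intro p; rw [← Complex.exp_add]; congr 1; ring
    simp only [matM, Matrix.toBlocks₁₂, Matrix.toBlocks₂₁, Matrix.of_apply, mul_add,
      Complex.exp_add, hsq (.inl k), hsq (.inr l), waveNumber, cauchyW, Complex.conj_conj]
    have := Complex.exp_ne_zero (1 / 2 * z a γ w d x t (.inr l))
    field_simp

/-- The Schur complement of the odd block in `matK` is conjugate to a matrix with first row
`ρ l = e^{z + r}` and whose other rows are differences of rows of `matF`, up to multiples of `ρ`.
The conjugation also absorbs the branch of the logarithm: only `e^{z + r}` is left. -/
theorem det_matK [NeZero N] (ha : ∀ j, a j ≠ 0) (hw : ∀ k l, w k ≠ conj (w l))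
    (hα : ∀ k l, alpha a γ w k ≠ conj (alpha a γ w l)) (j : Fin n) {x t : ℝ}
    (hdet : (matM a γ w d x t).det ≠ 0) :
    (matK a γ w d j x t).det = (matM a γ w d x t).det * ∑ l, a j / (a j - conj (w l))
      * wave (waveNumber a γ w) (amplitude a γ w d) x t l
      * colX (waveNumber a γ w) (cauchyW w)
        (wave (waveNumber a γ w) (amplitude a γ w d) x t) l () := by
  have hV0 : ∀ k, conj (w k) ≠ 0 := fun k => by simpa using ne_zero_of_ne_conj hw k
  have haj : (a j : ℂ) ≠ 0 := Complex.ofReal_ne_zero.2 (ha j)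
  rw [det_matM hw hα] at hdet ⊢
  set ζ : Idx N → ℂ := fun p => z a γ w d x t p + r a γ w j p with hζ
  have hexp_inr : ∀ l, Complex.exp (ζ (.inr l)) = a j / (a j - conj (w l))
      * wave (waveNumber a γ w) (amplitude a γ w d) x t l := fun l => by
    have h1 := sub_ne_zero_of_ne_conj hw (a j) l
    have h2 := sub_conj_ne_zero_of_ne_conj hw (a j) l
    have h3 := ne_zero_of_ne_conj hα l
    have h4 := ne_zero_of_ne_conj hw l
    rw [wave_eq]
    simp only [hζ, r]
    rw [Complex.exp_add, Complex.exp_neg, Complex.exp_conj, Complex.exp_log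
      (div_ne_zero h1 (mul_ne_zero (mul_ne_zero haj h4) h3))]
    simp only [map_div₀, map_mul, map_sub, Complex.conj_ofReal, inv_div]
    ring
  have hexp_inl : ∀ k, Complex.exp (ζ (.inl k)) = (a j - w k) / (a j * w k * alpha a γ w k)
      * Complex.exp (z a γ w d x t (.inl k)) := fun k => by
    have h1 := sub_ne_zero_of_ne_conj hw (a j) k
    have h3 := ne_zero_of_ne_conj hα k
    have h4 := ne_zero_of_ne_conj hw k
    simp only [hζ, r]
    rw [Complex.exp_add, Complex.exp_log
      (div_ne_zero h1 (mul_ne_zero (mul_ne_zero haj h4) h3)), mul_comm]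
  set F := matF (waveNumber a γ w) (cauchyW w)
    (wave (waveNumber a γ w) (amplitude a γ w d) x t) with hF
  have e : matK a γ w d j x t = Matrix.fromBlocks 1 (matK a γ w d j x t).toBlocks₁₂
      (matK a γ w d j x t).toBlocks₂₁ (matK a γ w d j x t).toBlocks₂₂ := by
    ext (i | i) (k | k) <;>
      simp [matK, Matrix.one_apply, Matrix.toBlocks₁₂, Matrix.toBlocks₂₁, Matrix.toBlocks₂₂]
  rw [e, Matrix.det_fromBlocks_one₁₁]
  -- the multiples of the first row in the other rows are `f i - f 0`
  set f : Fin N → ℂ := fun i => ∑ k, alpha a γ w k * Complex.exp (z a γ w d x t (.inl k))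
    / (conj (alpha a γ w i) - alpha a γ w k) with hf
  set T : Matrix (Fin N) (Fin N) ℂ := Matrix.of fun i l =>
    if i = 0 then Complex.exp (ζ (.inr l))
    else F i l - F 0 l + (f i - f 0) * Complex.exp (ζ (.inr l)) with hT
  have key := Matrix.det_of_row_differences (T := T) (F := F) 0
    (fun l => Complex.exp (ζ (.inr l))) (fun i => f i - f 0) hdet
    (fun l => by simp only [hT, Matrix.of_apply, if_true])
    (fun i l hi => by simp only [hT, Matrix.of_apply, if_neg hi])
  simp only [colX_apply, ← hF, ← hexp_inr]
  rw [← key]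
  refine Matrix.det_eq_of_forall_eq_mul_div
    (fun i => conj (w i) * Complex.exp (1 / 2 * ζ (.inr i)))
    (fun i => mul_ne_zero (hV0 i) (Complex.exp_ne_zero _)) fun i l => ?_
  have hsq : ∀ p, Complex.exp (ζ p)
      = Complex.exp (1 / 2 * ζ p) * Complex.exp (1 / 2 * ζ p) := by
    intro p; rw [← Complex.exp_add]; congr 1; ring
  have hVl := hV0 l
  have hVi := hV0 i
  have hVz := hV0 0
  have hel := Complex.exp_ne_zero (1 / 2 * ζ (.inr l))
  have hei := Complex.exp_ne_zero (1 / 2 * ζ (.inr i))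
  have hez := Complex.exp_ne_zero (1 / 2 * ζ (.inr 0))
  have hK21 : ∀ k, (matK a γ w d j x t).toBlocks₂₁ i k
      = alpha a γ w k ^ 2 * (conj (w i) / (conj (alpha a γ w i) - alpha a γ w k))
        * ((conj (alpha a γ w 0) - conj (alpha a γ w i)) / (conj (alpha a γ w 0) - alpha a γ w k))
        * (Complex.exp (1 / 2 * ζ (.inr i)) * Complex.exp (1 / 2 * ζ (.inl k))) := fun k => by
    rw [← Complex.exp_add, ← mul_add]; rfl
  have hK12 : ∀ k, (matK a γ w d j x t).toBlocks₁₂ k l = w k / (w k - conj (w l))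
        * (Complex.exp (1 / 2 * ζ (.inl k)) * Complex.exp (1 / 2 * ζ (.inr l))) := fun k => by
    rw [← Complex.exp_add, ← mul_add]; rfl
  have hK22 : (matK a γ w d j x t).toBlocks₂₂ i l
      = (if 0 = i then 1 else 0) * (conj (w i) / conj (w l))
          * (Complex.exp (1 / 2 * ζ (.inr 0)) * Complex.exp (1 / 2 * ζ (.inr l)))
        + (if i = l then 1 else 0) - (if 0 = i then 1 else 0) * (if 0 = l then 1 else 0)
        + (if 0 = l then 1 else 0) * ((if 0 = i then 1 else 0) - 1) * (conj (w i) / conj (w 0))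
          * (Complex.exp (1 / 2 * ζ (.inr i)) / Complex.exp (1 / 2 * ζ (.inr 0))) := by
    rw [← Complex.exp_add, ← mul_add, ← Complex.exp_sub, ← mul_sub]; rfl
  rw [Matrix.sub_apply, Matrix.mul_apply]
  by_cases hi : i = 0
  · subst hi
    simp only [hK21, sub_self, zero_div, mul_zero, zero_mul, Finset.sum_const_zero, sub_zero, hK22,
      hT, Matrix.of_apply, if_true, hsq (.inr l)]
    split_ifs <;> field_simp <;> ring
  · -- `f` absorbs the difference between the polarized and the unpolarized Cauchy kernels
    have hFf : ∀ m, F m l + f m * Complex.exp (ζ (.inr l)) = (1 : Matrix (Fin N) (Fin N) ℂ) m l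
        - ∑ k, alpha a γ w k ^ 2 * (w k * conj (w l) / (w k - conj (w l)))
          * Complex.exp (ζ (.inl k)) * Complex.exp (ζ (.inr l))
          * (conj (alpha a γ w m) - alpha a γ w k)⁻¹ := fun m => by
      rw [hF, matF_apply, hf, Finset.sum_mul, sub_add, ← Finset.sum_sub_distrib]
      congr 1
      refine Finset.sum_congr rfl fun k _ => ?_
      have h1 : conj (alpha a γ w m) - alpha a γ w k ≠ 0 := sub_ne_zero.2 (hα k m).symm
      have h2 := sub_ne_zero.2 (hw k l)
      have h3 := ne_zero_of_ne_conj hα k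
      have h4 := ne_zero_of_ne_conj hw k
      have h5 := sub_conj_ne_zero_of_ne_conj hw (a j) l
      rw [conj_wave_eq, hexp_inl, hexp_inr]
      simp only [waveNumber, cauchyW, Complex.conj_conj, Matrix.of_apply]
      field_simp
      ring
    have hFd : F i l - F 0 l + (f i - f 0) * Complex.exp (ζ (.inr l))
        = (1 : Matrix (Fin N) (Fin N) ℂ) i l - (1 : Matrix (Fin N) (Fin N) ℂ) 0 l
          - ∑ k, alpha a γ w k ^ 2 * (w k * conj (w l) / (w k - conj (w l)))
            * Complex.exp (ζ (.inl k)) * Complex.exp (ζ (.inr l))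
            * ((conj (alpha a γ w i) - alpha a γ w k)⁻¹
              - (conj (alpha a γ w 0) - alpha a γ w k)⁻¹) := by
      simp only [mul_sub, Finset.sum_sub_distrib]
      linear_combination hFf i - hFf 0
    simp only [hT, Matrix.of_apply, if_neg hi]
    rw [hFd, mul_sub, sub_div, Finset.mul_sum, Finset.sum_div]
    congr 1
    · rw [hK22, Matrix.one_apply, Matrix.one_apply]
      simp only [if_neg (Ne.symm hi)]
      by_cases hl : 0 = l
      · subst hl; simp only [if_true, if_neg hi]; field_simp; ring
      · simp only [if_neg hl]
        by_cases hil : i = l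
        · subst hil; simp only [if_true]; field_simp; ring
        · simp only [if_neg hil]; ring
    · refine Finset.sum_congr rfl fun k _ => ?_
      have h1 : conj (alpha a γ w i) - alpha a γ w k ≠ 0 := sub_ne_zero.2 (hα k i).symm
      have h1' : conj (alpha a γ w 0) - alpha a γ w k ≠ 0 := sub_ne_zero.2 (hα k 0).symm
      have h2 := sub_ne_zero.2 (hw k l)
      rw [hK21, hK12, hsq (.inl k), hsq (.inr l)]
      field_simp
      ring

theorem psi_eq_colPsi [NeZero N] (θ : ℝ) (ha : ∀ j, a j ≠ 0) (hw : ∀ k l, w k ≠ conj (w l))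
    (hα : ∀ k l, alpha a γ w k ≠ conj (alpha a γ w l)) (j : Fin n) {x t : ℝ}
    (hdet : (matM a γ w d x t).det ≠ 0) :
    psi a γ θ w d j x t = colPsi (waveNumber a γ w) (cauchyW w) (polarization a γ w θ)
      (wave (waveNumber a γ w) (amplitude a γ w d) x t) j () := by
  rw [psi, det_matK ha hw hα j hdet, mul_div_cancel_left₀ _ hdet, colPsi_apply, Finset.mul_sum]
  refine Finset.sum_congr rfl fun l _ => ?_
  simp only [polarization, Matrix.of_apply, mul_assoc]

theorem isNLSSolutionOn_psi [NeZero N] (θ : ℝ) (ha : ∀ j, a j ≠ 0)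
    (hw : ∀ k l, w k ≠ conj (w l)) (hα : ∀ k l, alpha a γ w k ≠ conj (alpha a γ w l)) :
    IsNLSSolutionOn (fun j => (SignType.sign (γ j) : ℝ)) (psi a γ θ w d)
      {p : ℝ × ℝ | (matM a γ w d p.1 p.2).det ≠ 0} := by
  have hpsi := fun j x t => psi_eq_colPsi (d := d) θ ha hw hα j (x := x) (t := t)
  have hM := fun x t => det_matM (d := d) hw hα x t
  have hU : {p : ℝ × ℝ | (matM a γ w d p.1 p.2).det ≠ 0} = {p : ℝ × ℝ | (matF (waveNumber a γ w)
      (cauchyW w) (wave (waveNumber a γ w) (amplitude a γ w d) p.1 p.2)).det ≠ 0} := by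
    simp only [hM]
  refine ⟨fun j => ?_, fun x t hxt j => ?_⟩
  · refine ContDiffOn.congr ?_ fun p hp => hpsi j p.1 p.2 hp
    rw [hU]
    exact contDiffOn_colPsi _ _ _ _ j
  · have hB : ∀ i k, waveNumber a γ w i ≠ conj (waveNumber a γ w k) := fun i k h =>
      hα k i (by simpa [waveNumber] using h.symm)
    have hx : ∀ᶠ y in nhds x, (matM a γ w d y t).det ≠ 0 := by
      simp only [hM]
      exact (hasEntryDerivAt_matF (fun l => hasDerivAt_wave_fst _ _ x t l)
        (matR_mul_diagonal (cauchyW_mul_sub θ ha hw) _)).eventually_det_ne_zero (hM x t ▸ hxt)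
    have ht : ∀ᶠ τ in nhds t, (matM a γ w d x τ).det ≠ 0 := by
      simp only [hM]
      exact (hasEntryDerivAt_matF (Q := matR (cauchyW w) _ * Matrix.diagonal _
        - Matrix.diagonal _ * matR (cauchyW w) _) (fun l => hasDerivAt_wave_snd _ _ x t l)
        (by abel)).eventually_det_ne_zero (hM x t ▸ hxt)
    have e1 : (fun τ => psi a γ θ w d j x τ) =ᶠ[nhds t] _ := ht.mono fun τ h => hpsi j x τ h
    have e2 : (fun y => psi a γ θ w d j y t) =ᶠ[nhds x] _ := hx.mono fun y h => hpsi j y t h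
    rw [e1.deriv_eq, e2.iteratedDeriv_eq]
    have hxt' : (matM a γ w d x t).det ≠ 0 := hxt
    simp only [hpsi _ x t hxt']
    exact colPsi_solves hB (cauchyW_conjTranspose w) (cauchyW_mul_sub θ ha hw) _
      (hM x t ▸ hxt') j

end BrightSoliton

namespace VectorSoliton

open Matrix Filter Topology

/-! ### Behaviour for large wave factors -/

section Cauchy

variable {ι : Type*} [DecidableEq ι]

/-- Cauchy matrices with distinct nodes are injective.  Clearing denominators gives a polynomial of
degree less than `#S` with `#S` roots, which therefore vanishes. -/
theorem eq_zero_of_sum_cauchy_eq_zero {S : Finset ι} {u v : ι → ℂ} (hu : Set.InjOn u S)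
    (hv : Set.InjOn v S) (huv : ∀ k l, u k ≠ v l) {q : ι → ℂ}
    (h : ∀ k ∈ S, ∑ l ∈ S, (u k - v l)⁻¹ * q l = 0) : ∀ l ∈ S, q l = 0 := by
  set P : Polynomial ℂ :=
    ∑ l ∈ S, Polynomial.C (q l) * ∏ m ∈ S.erase l, (Polynomial.X - Polynomial.C (v m)) with hP
  have hdeg : P.degree < S.card := by
    rw [← Polynomial.mem_degreeLT]
    refine Submodule.sum_mem _ fun l hl => ?_
    rw [← Polynomial.smul_eq_C_mul]
    refine Submodule.smul_mem _ _ ?_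
    rw [Polynomial.mem_degreeLT, Polynomial.degree_prod]
    simp only [Polynomial.degree_X_sub_C, Finset.sum_const, nsmul_eq_mul, mul_one]
    rw [Finset.card_erase_of_mem hl]
    exact_mod_cast Nat.sub_lt (Finset.card_pos.2 ⟨l, hl⟩) one_pos
  have hzero : P = 0 := by
    refine Polynomial.eq_zero_of_degree_lt_of_eval_index_eq_zero _ hu hdeg fun k hk => ?_
    have e : P.eval (u k) = (∏ m ∈ S, (u k - v m)) * ∑ l ∈ S, (u k - v l)⁻¹ * q l := by
      simp only [hP, Polynomial.eval_finsetSum, Polynomial.eval_mul, Polynomial.eval_C,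
        Polynomial.eval_prod, Polynomial.eval_sub, Polynomial.eval_X, Finset.mul_sum]
      refine Finset.sum_congr rfl fun l hl => ?_
      rw [← Finset.mul_prod_erase S _ hl]
      have := sub_ne_zero.2 (huv k l)
      field_simp
    rw [e, h k hk, mul_zero]
  intro l hl
  have e : P.eval (v l) = q l * ∏ m ∈ S.erase l, (v l - v m) := by
    simp only [hP, Polynomial.eval_finsetSum, Polynomial.eval_mul, Polynomial.eval_C,
      Polynomial.eval_prod, Polynomial.eval_sub, Polynomial.eval_X]
    refine Finset.sum_eq_single_of_mem l hl fun k _ hkl => ?_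
    rw [Finset.prod_eq_zero (Finset.mem_erase.2 ⟨hkl.symm, hl⟩) (sub_self _), mul_zero]
  rw [hzero, Polynomial.eval_zero] at e
  refine (mul_eq_zero.1 e.symm).resolve_right (Finset.prod_ne_zero_iff.2 fun m hm => ?_)
  exact sub_ne_zero.2 fun hvm =>
    (Finset.mem_erase.1 hm).1 (hv (Finset.mem_erase.1 hm).2 hl hvm.symm)

end Cauchy

section Asymptotics

variable {ι κ : Type*} [Fintype ι] [DecidableEq ι]

/-- The Cauchy matrix with entries `1 / (B i - conj (B k))`. -/
def waveNumberCauchy (B : ι → ℂ) : Matrix ι ι ℂ := Matrix.of fun i k => (B i - conj (B k))⁻¹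

theorem matL_eq (B ε : ι → ℂ) :
    matL B ε = waveNumberCauchy B * Matrix.diagonal fun k => conj (ε k) := by
  ext i k
  rw [Matrix.mul_diagonal, waveNumberCauchy, matL, Matrix.of_apply, Matrix.of_apply, div_eq_inv_mul]

/-- The right-hand side `(0, 1)` of the block system equivalent to `F X = 1`. -/
def blockSource (ι : Type*) : ι ⊕ ι → ℂ := Sum.elim (fun _ => 0) fun _ => 1

/-- The block matrix with rows `(1, R)` and `(L, 1)`, after scaling its columns by the numbers
`conj (δ k)` and `δ k`; here `p` stands for the products `ε δ`.  For `δ = ε⁻¹` at the growing waves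
and `δ = 1` at the decaying ones, both `δ` and `p` converge. -/
def balanced (B : ι → ℂ) (H : Matrix ι ι ℂ) (δ p : ι → ℂ) : Matrix (ι ⊕ ι) (ι ⊕ ι) ℂ :=
  Matrix.fromBlocks (Matrix.diagonal fun k => conj (δ k)) (H * Matrix.diagonal p)
    (waveNumberCauchy B * Matrix.diagonal fun k => conj (p k)) (Matrix.diagonal δ)

theorem tendsto_balanced {α : Type*} {f : Filter α} (B : ι → ℂ) (H : Matrix ι ι ℂ)
    {δ p : α → ι → ℂ} {δ₀ p₀ : ι → ℂ} (hδ : Tendsto δ f (𝓝 δ₀)) (hp : Tendsto p f (𝓝 p₀)) :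
    Tendsto (fun x => balanced B H (δ x) (p x)) f (𝓝 (balanced B H δ₀ p₀)) := by
  have hδl := tendsto_pi_nhds.1 hδ
  have hpl := tendsto_pi_nhds.1 hp
  have hconj : ∀ {g : α → ℂ} {g₀ : ℂ}, Tendsto g f (𝓝 g₀) →
      Tendsto (fun x => conj (g x)) f (𝓝 (conj g₀)) :=
    fun h => (Complex.continuous_conj.tendsto _).comp h
  refine tendsto_pi_nhds.2 fun i => tendsto_pi_nhds.2 fun k => ?_
  rcases i with i | i <;> rcases k with k | k <;>
    simp only [balanced, Matrix.fromBlocks_apply₁₁, Matrix.fromBlocks_apply₁₂,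
      Matrix.fromBlocks_apply₂₁, Matrix.fromBlocks_apply₂₂, Matrix.mul_diagonal,
      Matrix.diagonal_apply]
  · split_ifs
    exacts [hconj (hδl i), tendsto_const_nhds]
  · exact (hpl k).const_mul _
  · exact (hconj (hpl k)).const_mul _
  · split_ifs
    exacts [hδl i, tendsto_const_nhds]

theorem balanced_eq (B : ι → ℂ) (H : Matrix ι ι ℂ) (ε δ : ι → ℂ) :
    balanced B H δ (fun l => ε l * δ l) = Matrix.fromBlocks 1 (matR H ε) (matL B ε) 1 *
      Matrix.diagonal (Sum.elim (fun k => conj (δ k)) δ) := by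
  rw [← Matrix.fromBlocks_diagonal, Matrix.fromBlocks_multiply, matL_eq, matR, balanced]
  simp [Matrix.mul_assoc, Matrix.diagonal_mul_diagonal]

theorem det_matF_ne_zero_of_balanced {B : ι → ℂ} {H : Matrix ι ι ℂ} {ε δ : ι → ℂ}
    (h : (balanced B H δ fun l => ε l * δ l).det ≠ 0) : (matF B H ε).det ≠ 0 := by
  rw [balanced_eq, Matrix.det_mul, Matrix.det_fromBlocks_one₁₁] at h
  exact left_ne_zero_of_mul h

/-- The terms of which `Ψ` is composed, through the scaled block system. -/
theorem wave_mul_colX_eq {B : ι → ℂ} {H : Matrix ι ι ℂ} {ε δ : ι → ℂ}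
    (h : (balanced B H δ fun l => ε l * δ l).det ≠ 0) (l : ι) :
    ε l * colX B H ε l () = ε l * δ l *
      ((balanced B H δ fun l => ε l * δ l)⁻¹ *ᵥ blockSource ι) (.inr l) := by
  set y := (balanced B H δ fun l => ε l * δ l)⁻¹ *ᵥ blockSource ι with hy
  set v := Matrix.diagonal (Sum.elim (fun k => conj (δ k)) δ) *ᵥ y with hv
  have h1 : Matrix.fromBlocks 1 (matR H ε) (matL B ε) 1 *ᵥ v = blockSource ι := by
    rw [hv, Matrix.mulVec_mulVec, ← balanced_eq, hy, Matrix.mulVec_mulVec,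
      Matrix.mul_nonsing_inv _ (isUnit_iff_ne_zero.2 h), Matrix.one_mulVec]
  rw [Matrix.fromBlocks_mulVec, Matrix.one_mulVec, Matrix.one_mulVec] at h1
  have h2 : v ∘ Sum.inl + matR H ε *ᵥ (v ∘ Sum.inr) = 0 :=
    funext fun k => congrFun h1 (.inl k)
  have h3 : matL B ε *ᵥ (v ∘ Sum.inl) + v ∘ Sum.inr = 1 :=
    funext fun k => congrFun h1 (.inr k)
  have h4 : matF B H ε *ᵥ (v ∘ Sum.inr) = 1 := by
    rw [← h3, matF, Matrix.sub_mulVec, Matrix.one_mulVec, ← Matrix.mulVec_mulVec,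
      eq_neg_of_add_eq_zero_left h2, Matrix.mulVec_neg]
    abel
  have h5 : v ∘ Sum.inr = (matF B H ε)⁻¹ *ᵥ 1 := by
    rw [← h4, Matrix.mulVec_mulVec,
      Matrix.nonsing_inv_mul _ (isUnit_iff_ne_zero.2 (det_matF_ne_zero_of_balanced h)),
      Matrix.one_mulVec]
  have h6 : colX B H ε l () = v (.inr l) := by
    rw [colX_apply]
    have := congrFun h5 l
    simp only [Function.comp_apply, Matrix.mulVec, dotProduct, Pi.one_apply, mul_one] at this
    exact this.symm
  rw [h6, hv, Matrix.mulVec_diagonal, Sum.elim_inr, mul_assoc]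

/-- The system with the columns of `M` at `S` and the unit vectors outside `S` has a trivial kernel
if the block of `M` at `S` is injective. -/
theorem eq_zero_of_mixed_system {S : Finset ι} {M : Matrix ι ι ℂ}
    (hM : ∀ q : ι → ℂ, (∀ k ∈ S, ∑ l ∈ S, M k l * q l = 0) → ∀ l ∈ S, q l = 0) {q₁ q₂ : ι → ℂ}
    (h : ∀ k, (if k ∈ S then 0 else 1) * q₁ k
      + ∑ l, M k l * (if l ∈ S then 1 else 0) * q₂ l = 0) :
    (∀ l ∈ S, q₂ l = 0) ∧ ∀ k ∉ S, q₁ k = 0 := by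
  have hsum : ∀ k, ∑ l, M k l * (if l ∈ S then 1 else 0) * q₂ l = ∑ l ∈ S, M k l * q₂ l := by
    intro k
    simp [mul_ite, ite_mul, Finset.sum_ite_mem]
  simp only [hsum] at h
  have h2 : ∀ l ∈ S, q₂ l = 0 := hM q₂ fun k hk => by simpa [hk] using h k
  refine ⟨h2, fun k hk => ?_⟩
  have := h k
  rwa [if_neg hk, one_mul, Finset.sum_eq_zero (fun l hl => by rw [h2 l hl, mul_zero]),
    add_zero] at this

section Limit

variable {S : Finset ι} {B : ι → ℂ} {H : Matrix ι ι ℂ}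

theorem balanced_mulVec_inl (δ p : ι → ℂ) (v : ι ⊕ ι → ℂ) (k : ι) :
    (balanced B H δ p *ᵥ v) (.inl k)
      = conj (δ k) * v (.inl k) + ∑ l, H k l * p l * v (.inr l) := by
  rw [balanced, Matrix.fromBlocks_mulVec, Sum.elim_inl, Pi.add_apply, Matrix.mulVec_diagonal]
  simp only [Matrix.mulVec, dotProduct, Matrix.mul_diagonal, Function.comp_apply]

theorem balanced_mulVec_inr (δ p : ι → ℂ) (v : ι ⊕ ι → ℂ) (k : ι) :
    (balanced B H δ p *ᵥ v) (.inr k)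
      = δ k * v (.inr k) + ∑ l, waveNumberCauchy B k l * conj (p l) * v (.inl l) := by
  rw [balanced, Matrix.fromBlocks_mulVec, Sum.elim_inr, Pi.add_apply, Matrix.mulVec_diagonal,
    add_comm]
  simp only [Matrix.mulVec, dotProduct, Matrix.mul_diagonal, Function.comp_apply]

theorem eq_zero_of_balanced_limit_mulVec_inl
    (hH : ∀ q : ι → ℂ, (∀ k ∈ S, ∑ l ∈ S, H k l * q l = 0) → ∀ l ∈ S, q l = 0)
    {v : ι ⊕ ι → ℂ}
    (h : ∀ k, (balanced B H (fun l => if l ∈ S then 0 else 1)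
      (fun l => if l ∈ S then 1 else 0) *ᵥ v) (.inl k) = 0) :
    (∀ l ∈ S, v (.inr l) = 0) ∧ ∀ k ∉ S, v (.inl k) = 0 := by
  simp only [balanced_mulVec_inl, apply_ite conj, map_zero, map_one] at h
  exact eq_zero_of_mixed_system hH h

theorem det_balanced_limit_ne_zero
    (hH : ∀ q : ι → ℂ, (∀ k ∈ S, ∑ l ∈ S, H k l * q l = 0) → ∀ l ∈ S, q l = 0)
    (hZ : ∀ q : ι → ℂ, (∀ k ∈ S, ∑ l ∈ S, waveNumberCauchy B k l * q l = 0) → ∀ l ∈ S, q l = 0) :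
    (balanced B H (fun l => if l ∈ S then 0 else 1) (fun l => if l ∈ S then 1 else 0)).det
      ≠ 0 := by
  intro hdet
  obtain ⟨v, hv, h⟩ := Matrix.exists_mulVec_eq_zero_iff.2 hdet
  have h1 := eq_zero_of_balanced_limit_mulVec_inl hH fun k => congrFun h (.inl k)
  have h2 := fun k => congrFun h (.inr k)
  simp only [balanced_mulVec_inr, apply_ite conj, map_zero, map_one, Pi.zero_apply] at h2
  have h3 := eq_zero_of_mixed_system hZ h2
  refine hv (funext ?_)
  rintro (k | k) <;> by_cases hk : k ∈ S
  · exact h3.1 k hk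
  · exact h1.2 k hk
  · exact h1.1 k hk
  · exact h3.2 k hk

theorem tendsto_inv_mulVec {ν : Type*} [Fintype ν] [DecidableEq ν] {f : Filter ℝ}
    {A : ℝ → Matrix ν ν ℂ} {A₀ : Matrix ν ν ℂ} (hA : Tendsto A f (𝓝 A₀)) (h₀ : A₀.det ≠ 0)
    (b : ν → ℂ) : Tendsto (fun x => (A x)⁻¹ *ᵥ b) f (𝓝 (A₀⁻¹ *ᵥ b)) := by
  have hinv : ContinuousAt Inv.inv A₀ := by
    refine continuousAt_matrix_inv _ ?_
    rw [Ring.inverse_eq_inv']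
    exact continuousAt_inv₀ h₀
  have hc : Continuous fun M : Matrix ν ν ℂ => M *ᵥ b :=
    continuous_id.matrix_mulVec continuous_const
  exact (hc.tendsto _).comp (hinv.tendsto.comp hA)

theorem tendsto_colPsi_zero_of_balanced {f : Filter ℝ} {ε δ : ℝ → ι → ℂ} {δ₀ p₀ : ι → ℂ}
    (hδ : Tendsto δ f (𝓝 δ₀)) (hp : Tendsto (fun x l => ε x l * δ x l) f (𝓝 p₀))
    (h₀ : (balanced B H δ₀ p₀).det ≠ 0)
    (hy₀ : ∀ l, p₀ l * ((balanced B H δ₀ p₀)⁻¹ *ᵥ blockSource ι) (.inr l) = 0) :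
    (∀ᶠ x in f, (matF B H (ε x)).det ≠ 0) ∧ ∀ (C : Matrix κ ι ℂ) (j : κ),
      Tendsto (fun x => colPsi B H C (ε x) j ()) f (𝓝 0) := by
  have hN : Tendsto (fun x => balanced B H (δ x) fun l => ε x l * δ x l) f
      (𝓝 (balanced B H δ₀ p₀)) := tendsto_balanced B H hδ hp
  have hc : Continuous fun M : Matrix (ι ⊕ ι) (ι ⊕ ι) ℂ => M.det := continuous_id.matrix_det
  have hdet : ∀ᶠ x in f, (balanced B H (δ x) fun l => ε x l * δ x l).det ≠ 0 :=
    ((hc.tendsto _).comp hN).eventually_ne h₀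
  refine ⟨hdet.mono fun x hx => det_matF_ne_zero_of_balanced hx, fun C j => ?_⟩
  have hX : ∀ l, Tendsto (fun x => ε x l * colX B H (ε x) l ()) f (𝓝 0) := fun l => by
    rw [← hy₀ l]
    exact ((tendsto_pi_nhds.1 hp l).mul
      (tendsto_pi_nhds.1 (tendsto_inv_mulVec hN h₀ (blockSource ι)) (.inr l))).congr'
        (hdet.mono fun x hx => (wave_mul_colX_eq hx l).symm)
  simp only [colPsi_apply, mul_assoc]
  have := tendsto_finsetSum Finset.univ fun l _ => (hX l).const_mul (C j l)
  simpa only [mul_zero, Finset.sum_const_zero] using this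

/-- If each wave factor tends to `0` or to infinity (the latter for the indices in `S`) and the
blocks of `H` and of the Cauchy matrix at `S` are injective, then `Ψ` tends to `0`: at a decaying
wave the product `p = ε δ` tends to `0`, and at a growing one the solution of the limiting scaled
system vanishes. -/
theorem tendsto_colPsi_zero {f : Filter ℝ} {ε : ℝ → ι → ℂ} (hε : ∀ x l, ε x l ≠ 0)
    (hS : ∀ l ∈ S, Tendsto (fun x => (ε x l)⁻¹) f (𝓝 0))
    (hS' : ∀ l ∉ S, Tendsto (fun x => ε x l) f (𝓝 0))
    (hH : ∀ q : ι → ℂ, (∀ k ∈ S, ∑ l ∈ S, H k l * q l = 0) → ∀ l ∈ S, q l = 0)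
    (hZ : ∀ q : ι → ℂ, (∀ k ∈ S, ∑ l ∈ S, waveNumberCauchy B k l * q l = 0) → ∀ l ∈ S, q l = 0) :
    (∀ᶠ x in f, (matF B H (ε x)).det ≠ 0) ∧ ∀ (C : Matrix κ ι ℂ) (j : κ),
      Tendsto (fun x => colPsi B H C (ε x) j ()) f (𝓝 0) := by
  have h₀ := det_balanced_limit_ne_zero hH hZ
  refine tendsto_colPsi_zero_of_balanced (δ := fun x l => if l ∈ S then (ε x l)⁻¹ else 1)
    (tendsto_pi_nhds.2 fun l => ?_) (tendsto_pi_nhds.2 fun l => ?_) h₀ fun l => ?_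
  · by_cases hl : l ∈ S
    · simpa only [if_pos hl] using hS l hl
    · simpa only [if_neg hl] using tendsto_const_nhds
  · by_cases hl : l ∈ S
    · simpa only [if_pos hl, mul_inv_cancel₀ (hε _ l)] using tendsto_const_nhds
    · simpa only [if_neg hl, mul_one] using hS' l hl
  · by_cases hl : l ∈ S
    · set A := balanced B H (fun l => if l ∈ S then 0 else 1) fun l => if l ∈ S then 1 else 0
        with hA
      have hy : A *ᵥ (A⁻¹ *ᵥ blockSource ι) = blockSource ι := by
        rw [Matrix.mulVec_mulVec, Matrix.mul_nonsing_inv _ (isUnit_iff_ne_zero.2 h₀),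
          Matrix.one_mulVec]
      rw [(eq_zero_of_balanced_limit_mulVec_inl (B := B) hH
        fun k => congrFun hy (.inl k)).1 l hl, mul_zero]
    · rw [if_neg hl, zero_mul]

end Limit

end Asymptotics

section WaveAsymptotics

variable {ι : Type*}

theorem norm_wave (B c : ι → ℂ) (x t : ℝ) (l : ι) :
    ‖wave B c x t l‖ = ‖c l‖ * Real.exp ((B l).im * x + (B l ^ 2).im * t) := by
  rw [wave, norm_mul, Complex.norm_exp]
  congr 2
  simp

theorem tendsto_wave_zero {B : ι → ℂ} (c : ι → ℂ) (t : ℝ) {l : ι} {f : Filter ℝ}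
    (h : Tendsto (fun x => (B l).im * x) f atBot) :
    Tendsto (fun x => wave B c x t l) f (𝓝 0) := by
  rw [tendsto_zero_iff_norm_tendsto_zero]
  simp only [norm_wave]
  simpa using (Real.tendsto_exp_atBot.comp
    (tendsto_atBot_add_const_right f ((B l ^ 2).im * t) h)).const_mul ‖c l‖

theorem tendsto_inv_wave_zero {B c : ι → ℂ} (t : ℝ) {l : ι} {f : Filter ℝ}
    (h : Tendsto (fun x => (B l).im * x) f atTop) :
    Tendsto (fun x => (wave B c x t l)⁻¹) f (𝓝 0) := by
  rw [tendsto_zero_iff_norm_tendsto_zero]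
  simp only [norm_inv, norm_wave, mul_inv, ← Real.exp_neg]
  simpa using (Real.tendsto_exp_atBot.comp (tendsto_neg_atTop_atBot.comp
    (tendsto_atTop_add_const_right f ((B l ^ 2).im * t) h))).const_mul ‖c l‖⁻¹

end WaveAsymptotics

end VectorSoliton

namespace BrightSoliton

open VectorSoliton Filter Topology

variable {n N : ℕ} {a γ : Fin n → ℝ} {w d : Fin N → ℂ}

/-- Decay along a filter under which the waves with index in `S` grow and the others decay; it is
applied at `+∞` and at `-∞` with complementary sets `S`. -/
theorem tendsto_psi_of_tendsto_im_mul [NeZero N] (θ : ℝ) (ha : ∀ j, a j ≠ 0)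
    (hw : ∀ k l, w k ≠ conj (w l)) (hα : ∀ k l, alpha a γ w k ≠ conj (alpha a γ w l))
    (hinj : Function.Injective (alpha a γ w)) (t : ℝ) {f : Filter ℝ} {S : Finset (Fin N)}
    (hS : ∀ l ∈ S, Tendsto (fun x => (waveNumber a γ w l).im * x) f atTop)
    (hS' : ∀ l ∉ S, Tendsto (fun x => (waveNumber a γ w l).im * x) f atBot) :
    (∀ᶠ x in f, (matM a γ w d x t).det ≠ 0) ∧
      ∀ j, Tendsto (fun x => psi a γ θ w d j x t) f (𝓝 0) := by
  -- `alpha` is a function of `w k`, so that its injectivity passes to `w`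
  have hwinj : Function.Injective w := fun k l h => hinj (by simp only [alpha, h])
  have hB : Function.Injective (waveNumber a γ w) :=
    (starRingEnd ℂ).injective.comp hinj
  have h := tendsto_colPsi_zero (κ := Fin n) (S := S) (f := f) (B := waveNumber a γ w)
    (H := cauchyW w) (ε := fun x => wave (waveNumber a γ w) (amplitude a γ w d) x t)
    (fun x l => mul_ne_zero (mul_ne_zero (mul_ne_zero
      (by simpa using ne_zero_of_ne_conj hw l) (by simpa using ne_zero_of_ne_conj hα l))
      (Complex.exp_ne_zero _)) (Complex.exp_ne_zero _))
    (fun l hl => tendsto_inv_wave_zero t (hS l hl)) (fun l hl => tendsto_wave_zero _ t (hS' l hl))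
    (fun q hq => eq_zero_of_sum_cauchy_eq_zero (u := w) (v := fun l => conj (w l))
      hwinj.injOn ((starRingEnd ℂ).injective.comp hwinj).injOn hw hq)
    (fun q hq => eq_zero_of_sum_cauchy_eq_zero (u := waveNumber a γ w)
      (v := fun l => conj (waveNumber a γ w l)) hB.injOn
      ((starRingEnd ℂ).injective.comp hB).injOn
      (fun k l e => hα l k (by simpa [waveNumber] using e.symm)) hq)
  have hdet : ∀ᶠ x in f, (matM a γ w d x t).det ≠ 0 := by
    simpa only [det_matM hw hα] using h.1
  exact ⟨hdet, fun j => (h.2 (polarization a γ w θ) j).congr'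
    (hdet.mono fun x hx => (psi_eq_colPsi θ ha hw hα j hx).symm)⟩

theorem tendsto_psi_cocompact [NeZero N] (θ : ℝ) (ha : ∀ j, a j ≠ 0)
    (hw : ∀ k l, w k ≠ conj (w l)) (hα : ∀ k l, alpha a γ w k ≠ conj (alpha a γ w l))
    (hinj : Function.Injective (alpha a γ w)) (t : ℝ) :
    (∀ᶠ x in cocompact ℝ, (matM a γ w d x t).det ≠ 0) ∧
      ∀ j, Tendsto (fun x => psi a γ θ w d j x t) (cocompact ℝ) (𝓝 0) := by
  have him : ∀ l, (waveNumber a γ w l).im ≠ 0 := fun l h => by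
    refine hα l l ?_
    have := Complex.conj_eq_iff_im.2 h
    simpa [waveNumber] using this
  have hbot := tendsto_psi_of_tendsto_im_mul (d := d) θ ha hw hα hinj t (f := atBot)
    (S := {l | (waveNumber a γ w l).im < 0})
    (fun l hl => tendsto_id.const_mul_atBot_of_neg (Finset.mem_filter.1 hl).2)
    (fun l hl => tendsto_id.const_mul_atBot (lt_of_le_of_ne
      (not_lt.1 fun h => hl (Finset.mem_filter.2 ⟨Finset.mem_univ _, h⟩)) (him l).symm))
  have htop := tendsto_psi_of_tendsto_im_mul (d := d) θ ha hw hα hinj t (f := atTop)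
    (S := {l | 0 < (waveNumber a γ w l).im})
    (fun l hl => tendsto_id.const_mul_atTop (Finset.mem_filter.1 hl).2)
    (fun l hl => tendsto_id.const_mul_atTop_of_neg (lt_of_le_of_ne
      (not_lt.1 fun h => hl (Finset.mem_filter.2 ⟨Finset.mem_univ _, h⟩)) (him l)))
  rw [cocompact_eq_atBot_atTop]
  exact ⟨eventually_sup.2 ⟨hbot.1, htop.1⟩, fun j => (hbot.2 j).sup (htop.2 j)⟩

end BrightSoliton

end

theorem mainTheorem3 {n N : ℕ} [NeZero N] (a γ : Fin n → ℝ) (θ : ℝ) (w d : Fin N → ℂ)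
    (ha : ∀ j, a j ≠ 0) (hγ : ∀ j, γ j ≠ 0)
    (hw : ∀ k l, w k ≠ (starRingEnd ℂ) (w l))
    (hα : ∀ k l, BrightSoliton.alpha a γ w k ≠ (starRingEnd ℂ) (BrightSoliton.alpha a γ w l)) :
    BrightSoliton.IsNLSSolutionOn (fun j => (SignType.sign (γ j) : ℝ))
        (BrightSoliton.psi a γ θ w d)
        {p : ℝ × ℝ | (BrightSoliton.matM a γ w d p.1 p.2).det ≠ 0} ∧
      (Function.Injective (BrightSoliton.alpha a γ w) →
        ∀ t : ℝ,
          (∀ᶠ x in Filter.cocompact ℝ, (BrightSoliton.matM a γ w d x t).det ≠ 0) ∧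
          ∀ j, Filter.Tendsto (fun x => BrightSoliton.psi a γ θ w d j x t)
            (Filter.cocompact ℝ) (nhds 0)) :=
  ⟨BrightSoliton.isNLSSolutionOn_psi θ ha hw hα,
    fun hinj t => BrightSoliton.tendsto_psi_cocompact θ ha hw hα hinj t⟩
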